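/- **Setting.** Let $1\le T_0<T$ and $n\ge 4T$. Let $X=M+E\in\mathbb R^{n\times T}$, where the signal matrix $M$ is deterministic with $r=\operatorname{rank}(M)<T$, and the entries of $E$ are independent $\mathcal N(0,s^2)$ random variables, $s\ge 0$. Let $x_0$ be a (possibly random) target time series of length $T$. ClusterSC works with the first $T_0$ (pre-intervention) columns $X^-$ of $X$ and entries $x_0^-$ of $x_0$: it computes a singular value decomposition $X^-=U\Sigma V^\top$, runs Lloyd's $k$-means method on the rows of $U\Sigma_r$, where $\Sigma_r$ keeps the $r$ largest singular values, finds the returned center nearest to $\tilde u=x_0^-V^{-\top}$ (with $x_0^-$ as a row vector), and selects the set $I\subseteq\{1,\dots,n\}$ of donors in the cluster of this center; the initialization, the number of rounds of Lloyd's method and the treatment of ties and of empty clusters are arbitrary. Let $A=S+E_S$ consist of the rows of $X=M+E$ with index in $I$, with $S$ and $E_S$ the corresponding rows of $M$ and $E$, and let $r_S=\operatorname{rank}(S)$. The set $I$ is a measurable function of the outcome, and $n_A:=\mathbb E|I|$. (Everything below holds also if $I$ is a fixed set of donors, in which case $n_A=|I|$.) Put $\sigma^*_X=\sigma_{r+1}(X)$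 and $\sigma^*_A=\sigma_{r_S+1}(A)$, where $\sigma_j$ is the $j$-th largest singular value, and $\sigma_j=0$ if $j$ exceeds the number of rows or columns. For $\mu>0$ and $\eta\ge0$ (bounds on the norms of the true and of the learned synthetic control weights), the upper bound on the post-intervention RMSE of synthetic control is $$B_X=\frac{\eta}{\sqrt{T-T_0}}\,\mathbb E\big[\sigma^*_X+2s(\sqrt n+\sqrt T)\big]+\sqrt n\,(\mu+\eta)$$ for the full donor pool $X$, and $$B_A=\frac{\eta}{\sqrt{T-T_0}}\,\mathbb E\big[\sigma^*_A+2s(\sqrt{|I|}+\sqrt T)\big]+\mathbb E\big[\sqrt{|I|}\,\big](\mu+\eta)$$ for the donor matrix $A$ selected by ClusterSC. **Theorem.** If $n_A<n+4T-4\sqrt{nT}$, then $B_A<B_X$. Moreover, the gap is $\Omega(s\sqrt n)$: if $\eta>0$, then for every $\alpha\in(0,1)$ there is a constant $c>0$, which depends only on $T,T_0,\mu,\eta,\alpha$, such that whenever $n_A<n+4T-4\sqrt{nT}$ and $n_A\le\alpha^2n$, $$B_X-B_A\ \ge\ c\,s\sqrt n .$$ -/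

import Mathlib

open MeasureTheory ProbabilityTheory
open scoped NNReal Matrix

noncomputable section

/-- The singular value `σ_{j+1}(A)` of a real matrix: singular values are listed in decreasing order
with multiplicity, starting at `j = 0`, and continued by zeros. -/
def singVal {m ι : Type*} [Fintype m] [Fintype ι] [DecidableEq ι]
    (A : Matrix m ι ℝ) (j : ℕ) : ℝ :=
  (Matrix.toEuclideanLin A).singularValues j

/-- For an observed matrix `A = S + E_S` with signal matrix `S` of rank `ρ`, the singular value
`σ*_A = σ_{ρ+1}(A)`. -/
def sigmaStar {m ι : Type*} [Fintype m] [Fintype ι] [DecidableEq ι]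
    (S A : Matrix m ι ℝ) : ℝ :=
  singVal A S.rank

/-- The submatrix formed by the rows with index in `I`. -/
def rowsOf {n T : ℕ} (A : Matrix (Fin n) (Fin T) ℝ) (I : Finset (Fin n)) :
    Matrix I (Fin T) ℝ :=
  A.submatrix (fun i => (i : Fin n)) id

/-- A run of Lloyd's method on the points `u 0, …, u (n-1)` with `k` centers. In every round each
point is labelled by a nearest current center, and each center with a nonempty cluster is moved to
the mean of its cluster. The initial centers, the treatment of ties and of empty clusters and
the number of rounds are left free. -/
structure LloydRun {n d : ℕ} (k : ℕ) (u : Fin n → EuclideanSpace ℝ (Fin d)) where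
  rounds : ℕ
  center : ℕ → Fin k → EuclideanSpace ℝ (Fin d)
  label : ℕ → Fin n → Fin k
  label_nearest : ∀ j i t, dist (u i) (center j (label j i)) ≤ dist (u i) (center j t)
  center_update : ∀ j t, (Finset.univ.filter fun i => label j i = t).Nonempty →
    center (j + 1) t = ((Finset.univ.filter fun i => label j i = t).card : ℝ)⁻¹ •
      ∑ i ∈ Finset.univ.filter (fun i => label j i = t), u i

/-- The learning and matching steps of ClusterSC on a pre-intervention donor matrix `X` (rows are
donors) and a pre-intervention target `x₀`, with approximate rank `r` and `k` clusters:
a singular value decomposition `X = U Σ Vᵀ`, a run of Lloyd's method on the rows of `U Σ_r`, where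
`Σ_r` keeps the `r` largest singular values, and a returned center nearest to `ũ = x₀ V⁻ᵀ`
(`x₀` as a row vector, the embedding which sends the rows of `X` to those of `U Σ`). -/
structure ClusterSCRun {n d : ℕ} (k r : ℕ) (X : Matrix (Fin n) (Fin d) ℝ) (x₀ : Fin d → ℝ) where
  U : Matrix (Fin n) (Fin d) ℝ
  sv : Fin d → ℝ
  V : Matrix (Fin d) (Fin d) ℝ
  U_orth : Uᵀ * U = 1
  V_orth : Vᵀ * V = 1
  sv_nonneg : ∀ j, 0 ≤ sv j
  sv_antitone : Antitone sv
  svd : X = U * Matrix.diagonal sv * Vᵀ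
  lloyd : LloydRun k fun i => WithLp.toLp 2
    ((U * Matrix.diagonal fun j : Fin d => if (j : ℕ) < r then sv j else 0) i)
  target : Fin k
  target_nearest : ∀ t,
    dist (lloyd.center lloyd.rounds target) (WithLp.toLp 2 (x₀ ᵥ* (Vᵀ)⁻¹)) ≤
      dist (lloyd.center lloyd.rounds t) (WithLp.toLp 2 (x₀ ᵥ* (Vᵀ)⁻¹))

/-- The donors selected by ClusterSC: the cluster of the center matched to the target. -/
def ClusterSCRun.donors {n d k r : ℕ} {X : Matrix (Fin n) (Fin d) ℝ} {x₀ : Fin d → ℝ}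
    (run : ClusterSCRun k r X x₀) : Finset (Fin n) :=
  Finset.univ.filter fun i => run.lloyd.label run.lloyd.rounds i = run.target

/-- `I` is a possible set of donors selected by ClusterSC with `k` clusters and rank parameter `r`
from the donor matrix `X` and the target `x₀`, of which only the `T₀` pre-intervention
periods are used. -/
def ClusterSCSelects {n T T₀ : ℕ} (hT : T₀ < T) (k r : ℕ)
    (X : Matrix (Fin n) (Fin T) ℝ) (x₀ : Fin T → ℝ) (I : Finset (Fin n)) : Prop :=
  ∃ run : ClusterSCRun k r (X.submatrix id (Fin.castLE hT.le)) (fun t => x₀ (Fin.castLE hT.le t)),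
    run.donors = I

/-- The entries of the random matrix `E` are independent `𝒩(0, s²)` variables. -/
def IsGaussianNoise {Ω : Type*} [MeasurableSpace Ω] (P : Measure Ω) {n T : ℕ} (s : ℝ≥0)
    (E : Ω → Matrix (Fin n) (Fin T) ℝ) : Prop :=
  iIndepFun (fun (p : Fin n × Fin T) ω => E ω p.1 p.2) P ∧
    ∀ i t, HasLaw (fun ω => E ω i t) (gaussianReal 0 (s ^ 2)) P

/-- The upper bound on the post-intervention RMSE of synthetic control,
`η / √(T - T₀) · 𝔼[σ* + 2 s (√m + √T)] + 𝔼[√m] (μ + η)`, for a donor matrix with `m` rows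
and truncated singular value `σ*`; both may depend on the outcome. -/
def postRMSEBound {Ω : Type*} [MeasurableSpace Ω] (P : Measure Ω) (T T₀ : ℕ) (μ η : ℝ) (s : ℝ≥0)
    (σ : Ω → ℝ) (m : Ω → ℕ) : ℝ :=
  η / √((T : ℝ) - T₀) * (∫ ω, (σ ω + 2 * (s : ℝ) * (√(m ω : ℝ) + √(T : ℝ))) ∂P) + (∫ ω, √(m ω : ℝ) ∂P) * (μ + η)

/-- The bound for synthetic control with the full donor pool `X = M + E`. -/
def fullPoolBound {Ω : Type*} [MeasurableSpace Ω] (P : Measure Ω) {n T : ℕ} (T₀ : ℕ) (μ η : ℝ)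
    (s : ℝ≥0) (M : Matrix (Fin n) (Fin T) ℝ) (E : Ω → Matrix (Fin n) (Fin T) ℝ) : ℝ :=
  postRMSEBound P T T₀ μ η s (fun ω => sigmaStar M (M + E ω)) (fun _ => n)

/-- The same bound for the donor matrix `A = S + E_S` formed by the rows of `X = M + E` with index
in the (outcome dependent) set `I`. -/
def selectedBound {Ω : Type*} [MeasurableSpace Ω] (P : Measure Ω) {n T : ℕ} (T₀ : ℕ) (μ η : ℝ)
    (s : ℝ≥0) (M : Matrix (Fin n) (Fin T) ℝ) (E : Ω → Matrix (Fin n) (Fin T) ℝ)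
    (I : Ω → Finset (Fin n)) : ℝ :=
  postRMSEBound P T T₀ μ η s
    (fun ω => sigmaStar (rowsOf M (I ω)) (rowsOf (M + E ω) (I ω))) (fun ω => (I ω).card)

/-- The (expected) number `n_A` of selected donors. -/
def meanSize {Ω : Type*} [MeasurableSpace Ω] (P : Measure Ω) {n : ℕ}
    (I : Ω → Finset (Fin n)) : ℝ :=
  ∫ ω, ((I ω).card : ℝ) ∂P

end

/-!
The whole theorem rests on one estimate for Gaussian noise: for a signal `M` of rank below `T`,
`𝔼 ‖E‖ - 𝔼 σ*_X ≤ 3 s √T` (`integral_opNorm_sub_integral_sigmaStar_le`). The selected set may depend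
on the noise, but `σ*_A ≤ ‖E_S‖ ≤ ‖E‖` holds for every set of rows, by Weyl's inequality
(`sigmaStar_rowsOf_le`), so nothing about the selection enters except its expected size. With
`D = √n - 𝔼 √|I|`, the term in `η` of `B_X - B_A` is at least
`η / √(T - T₀) · s (2 D - 3 √T)`, and the rest equals `D (μ + η)`. By Jensen's inequality the size
condition reads `D > 2 √T` because `n + 4 T - 4 √(n T) = (√n - 2 √T)²`. Hence both parts are
nonnegative, the second is positive, and the first is at least `η / √(T - T₀) · s D / 2`, where
`D ≥ (1 - α) √n` if `n_A ≤ α² n`.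

The Gaussian estimate comes from Gordon's comparison inequality. Let `G` be a standard Gaussian
matrix, `g` a standard Gaussian vector and `N` a seminorm bounded by the norm, or its negative. Then
`𝔼 min_{|v| = 1} N (G v) ≥ 𝔼 N g - √T` (`gordon_norm`). For `N = -‖·‖` this bounds `𝔼 ‖G‖` above by
`𝔼 ‖g‖ + √T`. For `N = ‖Q ·‖`, with `Q` the projection to the orthogonal complement of the range of
`M`, it bounds `𝔼 σ*_X / s` below by `𝔼 ‖Q g‖ - √T ≥ 𝔼 ‖g‖ - √(rank M) - √T`, since
`‖X v‖ ≥ ‖Q X v‖ = ‖Q E v‖`. In the difference `𝔼 ‖g‖` cancels.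

Gordon's inequality is proved by interpolating between the processes `(G v, z)` and `(g, ⟨h, v⟩)`
through a rotation (`integral_gaussianPi_le_of_interpolation`), with a soft minimum over a finite net
of the sphere in place of the minimum and `√(δ² + N²)` in place of `N`. Gaussian integration by parts
turns the derivative of the expectation into a sum over pairs of net points of the mixed derivatives
of the soft minimum, which are nonnegative, times `(1 - ⟨v, v'⟩) (1 - ⟨∇N, ∇'N⟩) ≥ 0`.
-/

/-! ### Singular values -/

section SingularValues

variable {E F : Type*} [NormedAddCommGroup E] [InnerProductSpace ℝ E] [FiniteDimensional ℝ E]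
  [NormedAddCommGroup F] [InnerProductSpace ℝ F] [FiniteDimensional ℝ F]

theorem LinearMap.norm_sq_apply_eq_sum_singularValues (A : E →ₗ[ℝ] F) {n : ℕ}
    (hn : Module.finrank ℝ E = n) (v : E) :
    ‖A v‖ ^ 2 = ∑ i : Fin n, A.singularValues i ^ 2 *
      ((A.isSymmetric_adjoint_comp_self.eigenvectorBasis hn).repr v i) ^ 2 := by
  set b := A.isSymmetric_adjoint_comp_self.eigenvectorBasis hn
  have h1 : ‖A v‖ ^ 2 = inner ℝ ((LinearMap.adjoint A ∘ₗ A) v) v := by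
    rw [LinearMap.comp_apply, LinearMap.adjoint_inner_left, real_inner_self_eq_norm_sq]
  rw [h1, ← b.sum_inner_mul_inner]
  refine Finset.sum_congr rfl fun i _ => ?_
  have h2 := A.isSymmetric_adjoint_comp_self.eigenvectorBasis_apply_self_apply hn v i
  rw [real_inner_comm, ← b.repr_apply_apply, ← b.repr_apply_apply, h2, A.sq_singularValues_fin hn]
  simp only [RCLike.ofReal_real_eq_id, id_eq]
  ring

/-- Weyl's perturbation inequality. A nonzero vector which is orthogonal to the right singular
vectors of `A` with index above `j` and to those of `B` with index below `j` exists by counting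
dimensions; comparing `‖A v‖` and `‖B v‖` there gives the bound. -/
theorem LinearMap.singularValues_le_add (A B : E →ₗ[ℝ] F) (j : ℕ) {C : ℝ} (hC : 0 ≤ C)
    (h : ∀ v, ‖A v - B v‖ ≤ C * ‖v‖) :
    A.singularValues j ≤ B.singularValues j + C := by
  by_cases hj : Module.finrank ℝ E ≤ j
  · rw [A.singularValues_of_finrank_le hj, B.singularValues_of_finrank_le hj]
    simpa using hC
  push Not at hj
  set n := Module.finrank ℝ E with hn
  set a := A.isSymmetric_adjoint_comp_self.eigenvectorBasis (n := n) rfl with ha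
  set b := B.isSymmetric_adjoint_comp_self.eigenvectorBasis (n := n) rfl with hb
  -- Index `j` itself is unconstrained, which leaves `n - 1` conditions on an `n`-dimensional space.
  let φ : E →ₗ[ℝ] ({i : Fin n // (i : ℕ) ≠ j} → ℝ) := LinearMap.pi fun i =>
    if j < (i : Fin n) then
      (LinearMap.proj (i : Fin n)) ∘ₗ (WithLp.linearEquiv 2 ℝ (Fin n → ℝ)).toLinearMap ∘ₗ
        a.repr.toLinearEquiv.toLinearMap
    else
      (LinearMap.proj (i : Fin n)) ∘ₗ (WithLp.linearEquiv 2 ℝ (Fin n → ℝ)).toLinearMap ∘ₗ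
        b.repr.toLinearEquiv.toLinearMap
  have hker : LinearMap.ker φ ≠ ⊥ := by
    apply LinearMap.ker_ne_bot_of_finrank_lt
    rw [Module.finrank_fintype_fun_eq_card]
    calc Fintype.card {i : Fin n // (i : ℕ) ≠ j} < Fintype.card (Fin n) :=
          Fintype.card_subtype_lt (x := ⟨j, hj⟩) (by simp)
      _ = Module.finrank ℝ E := by rw [Fintype.card_fin]
  obtain ⟨v, hv, hv0⟩ := (Submodule.ne_bot_iff _).1 hker
  have hφ : ∀ (i : Fin n) (hi : (i : ℕ) ≠ j), φ v ⟨i, hi⟩ = 0 := fun i hi => by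
    rw [LinearMap.mem_ker.1 hv]; rfl
  have hva : ∀ i : Fin n, j < (i : ℕ) → a.repr v i = 0 := fun i hi => by
    have := hφ i hi.ne'
    simpa [φ, hi] using this
  have hvb : ∀ i : Fin n, (i : ℕ) < j → b.repr v i = 0 := fun i hi => by
    have := hφ i hi.ne
    simpa [φ, hi.not_gt] using this
  have hnorm : ∀ e : OrthonormalBasis (Fin n) ℝ E, ‖v‖ ^ 2 = ∑ i, (e.repr v i) ^ 2 := fun e => by
    rw [← e.repr.norm_map v, EuclideanSpace.norm_sq_eq]; simp
  have h1 : (A.singularValues j * ‖v‖) ^ 2 ≤ ‖A v‖ ^ 2 := by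
    rw [A.norm_sq_apply_eq_sum_singularValues rfl, mul_pow, hnorm a, Finset.mul_sum]
    refine Finset.sum_le_sum fun i _ => ?_
    by_cases hi : j < (i : ℕ)
    · rw [← ha, hva i hi]; simp
    · exact mul_le_mul_of_nonneg_right (pow_le_pow_left₀ (A.singularValues_nonneg _)
        (A.singularValues_antitone (not_lt.1 hi)) 2) (sq_nonneg _)
  have h2 : ‖B v‖ ^ 2 ≤ (B.singularValues j * ‖v‖) ^ 2 := by
    rw [B.norm_sq_apply_eq_sum_singularValues rfl, mul_pow, hnorm b, Finset.mul_sum]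
    refine Finset.sum_le_sum fun i _ => ?_
    by_cases hi : (i : ℕ) < j
    · rw [← hb, hvb i hi]; simp
    · exact mul_le_mul_of_nonneg_right (pow_le_pow_left₀ (B.singularValues_nonneg _)
        (B.singularValues_antitone (not_lt.1 hi)) 2) (sq_nonneg _)
  have h1' := le_of_sq_le_sq h1 (norm_nonneg _)
  have h2' := le_of_sq_le_sq h2 (mul_nonneg (B.singularValues_nonneg _) (norm_nonneg _))
  have hvpos : 0 < ‖v‖ := norm_pos_iff.2 hv0
  have h3 : ‖A v‖ ≤ ‖B v‖ + C * ‖v‖ := by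
    calc ‖A v‖ = ‖B v + (A v - B v)‖ := by congr 1; abel
      _ ≤ _ := (norm_add_le _ _).trans (add_le_add le_rfl (h v))
  refine le_of_mul_le_mul_right ?_ hvpos
  linarith

/-- Every singular value with index below the dimension of the domain is attained as `‖A v‖` at a
unit vector. -/
theorem LinearMap.exists_norm_apply_eq_singularValues (A : E →ₗ[ℝ] F) {j : ℕ}
    (hj : j < Module.finrank ℝ E) : ∃ v : E, ‖v‖ = 1 ∧ ‖A v‖ = A.singularValues j := by
  set b := A.isSymmetric_adjoint_comp_self.eigenvectorBasis rfl with hb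
  refine ⟨b ⟨j, hj⟩, b.norm_eq_one _, ?_⟩
  have := A.norm_sq_apply_eq_sum_singularValues rfl (b ⟨j, hj⟩)
  rw [← hb, Finset.sum_eq_single ⟨j, hj⟩] at this
  · simp only [OrthonormalBasis.repr_self, PiLp.single_apply, if_true, one_pow,
      mul_one] at this
    exact (pow_left_inj₀ (norm_nonneg _) (A.singularValues_nonneg _) two_ne_zero).1 this
  · intro i _ hi
    simp [hi]
  · simp

end SingularValues

/-! ### Gaussian integration by parts and interpolation -/

/-- The standard Gaussian measure on `κ → ℝ`: the coordinates are independent `𝒩(0, 1)`. -/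
noncomputable abbrev gaussianPi (κ : Type*) [Fintype κ] : Measure (κ → ℝ) :=
  Measure.pi fun _ => gaussianReal 0 1

section Interpolation

theorem integrable_id_gaussianReal : Integrable (fun x : ℝ => x) (gaussianReal 0 1) :=
  (memLp_id_gaussianReal (μ := 0) (v := 1) 1).integrable (by simp)

theorem hasDerivAt_gaussianPDFReal_zero_one (x : ℝ) :
    HasDerivAt (gaussianPDFReal 0 1) (-x * gaussianPDFReal 0 1 x) x := by
  have h : gaussianPDFReal 0 1 = fun x : ℝ => (√(2 * Real.pi))⁻¹ * Real.exp (-x ^ 2 / 2) := by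
    ext x; simp [gaussianPDFReal]
  rw [h]
  have h1 : HasDerivAt (fun x : ℝ => -x ^ 2 / 2) (-x) x := by
    have := ((hasDerivAt_pow 2 x).neg).div_const 2
    refine this.congr_deriv ?_
    norm_num
    ring
  exact ((h1.exp).const_mul (√(2 * Real.pi))⁻¹).congr_deriv (by ring)

/-- Gaussian integration by parts on the line. -/
theorem integral_mul_gaussianReal_eq_integral_deriv {f f' : ℝ → ℝ} {C : ℝ}
    (hf : ∀ x, HasDerivAt f (f' x) x) (hC : ∀ x, |f x| ≤ C) (hC' : ∀ x, |f' x| ≤ C) :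
    ∫ x, x * f x ∂gaussianReal 0 1 = ∫ x, f' x ∂gaussianReal 0 1 := by
  have hf'm : Measurable f' := by
    have : f' = deriv f := funext fun x => (hf x).deriv.symm
    rw [this]; exact measurable_deriv f
  have hfc : Continuous f := continuous_iff_continuousAt.2 fun x => (hf x).continuousAt
  rw [integral_gaussianReal_eq_integral_smul one_ne_zero,
    integral_gaussianReal_eq_integral_smul one_ne_zero]
  have hp := integrable_gaussianPDFReal 0 1
  have hxp : Integrable fun x : ℝ => x * gaussianPDFReal 0 1 x := by
    have := integrable_id_gaussianReal
    rw [gaussianReal_of_var_ne_zero _ one_ne_zero] at this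
    rw [integrable_withDensity_iff_integrable_smul' (measurable_gaussianPDF _ _)
      (ae_of_all _ fun _ => gaussianPDF_lt_top)] at this
    refine this.congr (ae_of_all _ fun x => ?_)
    simp [toReal_gaussianPDF, mul_comm]
  have key := integral_mul_deriv_eq_deriv_mul_of_integrable (u := f) (u' := f')
    (v := gaussianPDFReal 0 1) (v' := fun x => -x * gaussianPDFReal 0 1 x)
    (fun x _ => hf x) (fun x _ => hasDerivAt_gaussianPDFReal_zero_one x)
    (by
      refine (hxp.neg.bdd_mul (c := C) hfc.aestronglyMeasurable (ae_of_all _ hC)).congr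
        (ae_of_all _ fun x => ?_)
      simp)
    (hp.bdd_mul (c := C) hf'm.aestronglyMeasurable (ae_of_all _ hC'))
    (hp.bdd_mul (c := C) hfc.aestronglyMeasurable (ae_of_all _ hC))
  simp only [smul_eq_mul]
  calc ∫ x, gaussianPDFReal 0 1 x * (x * f x)
      = - ∫ x, f x * (-x * gaussianPDFReal 0 1 x) := by
        rw [← integral_neg]; congr 1; ext x; ring
    _ = ∫ x, f' x * gaussianPDFReal 0 1 x := by rw [key, neg_neg]
    _ = _ := by congr 1; ext x; ring

variable {κ : Type*} [Fintype κ]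

theorem integrable_eval_gaussianPi (i : κ) : Integrable (fun w : κ → ℝ => w i) (gaussianPi κ) :=
  integrable_comp_eval (μ := fun _ : κ => gaussianReal 0 1) (i := i) integrable_id_gaussianReal

theorem integrable_norm_gaussianPi : Integrable (fun w : κ → ℝ => ‖w‖) (gaussianPi κ) := by
  have h : Integrable (fun w : κ → ℝ => ∑ i, ‖w i‖) (gaussianPi κ) :=
    integrable_finsetSum _ fun i _ => (integrable_eval_gaussianPi i).norm
  refine h.mono' continuous_norm.aestronglyMeasurable (ae_of_all _ fun w => ?_)
  rw [norm_norm]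
  exact (pi_norm_le_iff_of_nonneg (Finset.sum_nonneg fun i _ => norm_nonneg _)).2 fun i =>
    Finset.single_le_sum (f := fun i => ‖w i‖) (fun i _ => norm_nonneg _) (Finset.mem_univ i)

variable [DecidableEq κ]

/-- Resampling one coordinate independently leaves a product measure invariant. -/
theorem measurePreserving_update_pi (μ : Measure ℝ) [IsProbabilityMeasure μ] (i : κ) :
    MeasurePreserving (fun p : (κ → ℝ) × ℝ => Function.update p.1 i p.2)
      ((Measure.pi fun _ : κ => μ).prod μ) (Measure.pi fun _ : κ => μ) := by
  have hm : Measurable fun p : (κ → ℝ) × ℝ => Function.update p.1 i p.2 := by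
    refine measurable_pi_iff.2 fun j => ?_
    by_cases h : j = i
    · subst h; simpa using measurable_snd
    · simpa [h, Function.comp_def] using (measurable_pi_apply (X := fun _ : κ => ℝ) j).comp measurable_fst
  refine ⟨hm, (Measure.pi_eq fun s hs => ?_).symm⟩
  rw [Measure.map_apply hm (MeasurableSet.univ_pi hs)]
  have : (fun p : (κ → ℝ) × ℝ => Function.update p.1 i p.2) ⁻¹' (Set.univ.pi s) =
      (Set.univ.pi (Function.update s i Set.univ)) ×ˢ (s i) := by
    ext ⟨w, x⟩
    simp only [Set.mem_preimage, Set.mem_pi, Set.mem_univ, true_implies, Set.mem_prod]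
    constructor
    · intro h
      refine ⟨fun j => ?_, by simpa using h i⟩
      by_cases hj : j = i
      · subst hj; simp
      · simpa [hj] using h j
    · rintro ⟨h, hx⟩ j
      by_cases hj : j = i
      · subst hj; simpa using hx
      · simpa [hj] using h j
  rw [this, Measure.prod_prod, Measure.pi_pi, ← Finset.prod_erase_mul _ _ (Finset.mem_univ i),
    ← Finset.prod_erase_mul _ _ (Finset.mem_univ i)]
  simp only [Function.update_self, measure_univ, mul_one]
  congr 1
  refine Finset.prod_congr rfl fun j hj => ?_
  rw [Function.update_of_ne (Finset.ne_of_mem_erase hj)]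

/-- Gaussian integration by parts in one coordinate. -/
theorem integral_eval_mul_gaussianPi {f f' : (κ → ℝ) → ℝ} {C : ℝ} (i : κ)
    (hf : ∀ w, HasDerivAt (fun t => f (Function.update w i t)) (f' w) (w i))
    (hfm : Measurable f) (hfm' : Measurable f') (hC : ∀ w, |f w| ≤ C) (hC' : ∀ w, |f' w| ≤ C) :
    ∫ w, w i * f w ∂gaussianPi κ = ∫ w, f' w ∂gaussianPi κ := by
  have mp := measurePreserving_update_pi (κ := κ) (gaussianReal 0 1) i
  have int1 : Integrable (fun w : κ → ℝ => w i * f w) (gaussianPi κ) :=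
    (integrable_eval_gaussianPi i).mul_bdd (c := C) hfm.aestronglyMeasurable (ae_of_all _ hC)
  have int2 : Integrable f' (gaussianPi κ) :=
    Integrable.of_bound hfm'.aestronglyMeasurable C (ae_of_all _ hC')
  have e1 : ∀ g : (κ → ℝ) → ℝ, Integrable g (gaussianPi κ) →
      ∫ w, g w ∂gaussianPi κ =
        ∫ w, ∫ x, g (Function.update w i x) ∂gaussianReal 0 1 ∂gaussianPi κ := by
    intro g hg
    rw [← integral_prod (fun p : (κ → ℝ) × ℝ => g (Function.update p.1 i p.2))
      (mp.integrable_comp_of_integrable hg)]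
    conv_lhs => rw [gaussianPi, ← mp.map_eq]
    rw [integral_map mp.measurable.aemeasurable]
    rw [mp.map_eq]; exact hg.aestronglyMeasurable
  rw [e1 _ int1, e1 _ int2]
  congr 1; ext w
  simp only [Function.update_self]
  refine integral_mul_gaussianReal_eq_integral_deriv (C := C) (fun x => ?_)
    (fun x => hC _) (fun x => hC' _)
  simpa using hf (Function.update w i x)

variable {H : Type*} [NormedAddCommGroup H] [NormedSpace ℝ H]

/-- Gaussian interpolation: along the rotation `sin θ X + cos θ Y` of two Gaussian vectors `X`, `Y`
(linear images of one standard Gaussian vector), the derivative in `θ` of the expectation of `F` is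
the expectation of a contraction of the second derivative of `F`. If this contraction is nonnegative
then `𝔼 F(Y) ≤ 𝔼 F(X)`. -/
theorem integral_gaussianPi_le_of_interpolation (X Y : (κ → ℝ) →L[ℝ] H) {F : H → ℝ}
    {DF : H → H →L[ℝ] ℝ} {D2F : H → H → H → ℝ} {C : ℝ} (hC0 : 0 ≤ C)
    (hF : ∀ x, HasFDerivAt F (DF x) x)
    (hDF : ∀ x a b, HasDerivAt (fun t : ℝ => DF (x + t • a) b) (D2F x a b) 0)
    (hDFc : Continuous DF) (hD2c : ∀ a b, Continuous fun x => D2F x a b)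
    (hC : ∀ x b, |DF x b| ≤ C * ‖b‖) (hC2 : ∀ a b, ∃ K, ∀ x, |D2F x a b| ≤ K)
    (hpos : ∀ θ ∈ Set.Ioo 0 (Real.pi / 2), ∀ x, 0 ≤ ∑ i : κ,
      D2F x (Real.sin θ • X (Pi.single i 1) + Real.cos θ • Y (Pi.single i 1))
        (Real.cos θ • X (Pi.single i 1) - Real.sin θ • Y (Pi.single i 1))) :
    Integrable (fun w => F (Y w)) (gaussianPi κ) ∧ Integrable (fun w => F (X w)) (gaussianPi κ) ∧
      ∫ w, F (Y w) ∂gaussianPi κ ≤ ∫ w, F (X w) ∂gaussianPi κ := by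
  set Z : ℝ → (κ → ℝ) →L[ℝ] H := fun θ => Real.sin θ • X + Real.cos θ • Y with hZ
  set Z' : ℝ → (κ → ℝ) →L[ℝ] H := fun θ => Real.cos θ • X - Real.sin θ • Y with hZ'
  have hFc : Continuous F := continuous_iff_continuousAt.2 fun x => (hF x).continuousAt
  have hlip : ∀ x, |F x| ≤ |F 0| + C * ‖x‖ := by
    intro x
    have h := convex_univ.norm_image_sub_le_of_norm_hasFDerivWithin_le (𝕜 := ℝ) (C := C)
      (fun y _ => (hF y).hasFDerivWithinAt (s := Set.univ))
      (fun y _ => ContinuousLinearMap.opNorm_le_bound _ hC0 (hC y)) (Set.mem_univ 0)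
      (Set.mem_univ x)
    rw [sub_zero, Real.norm_eq_abs] at h
    have := abs_add_le (F 0) (F x - F 0)
    rw [add_sub_cancel] at this
    linarith
  have hZint : ∀ θ, Integrable (fun w => F (Z θ w)) (gaussianPi κ) := by
    intro θ
    have hb : Integrable (fun w : κ → ℝ => |F 0| + C * (‖Z θ‖ * ‖w‖)) (gaussianPi κ) :=
      (integrable_const _).add ((integrable_norm_gaussianPi.const_mul _).const_mul _)
    refine hb.mono' (hFc.comp (Z θ).continuous).aestronglyMeasurable (ae_of_all _ fun w => ?_)
    exact (hlip _).trans (by gcongr; exact (Z θ).le_opNorm w)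
  have hbound : ∀ θ w, ‖DF (Z θ w) (Z' θ w)‖ ≤ C * ((‖X‖ + ‖Y‖) * ‖w‖) := by
    intro θ w
    refine (hC _ _).trans ?_
    gcongr
    have h1 : ‖Real.cos θ • X w‖ ≤ ‖X‖ * ‖w‖ := by
      rw [norm_smul]
      exact (mul_le_of_le_one_left (norm_nonneg _) (Real.abs_cos_le_one θ)).trans (X.le_opNorm w)
    have h2 : ‖Real.sin θ • Y w‖ ≤ ‖Y‖ * ‖w‖ := by
      rw [norm_smul]
      exact (mul_le_of_le_one_left (norm_nonneg _) (Real.abs_sin_le_one θ)).trans (Y.le_opNorm w)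
    calc ‖Z' θ w‖ ≤ ‖Real.cos θ • X w‖ + ‖Real.sin θ • Y w‖ := norm_sub_le _ _
      _ ≤ _ := by linarith
  have hderiv : ∀ θ, HasDerivAt (fun θ => ∫ w, F (Z θ w) ∂gaussianPi κ)
      (∫ w, DF (Z θ w) (Z' θ w) ∂gaussianPi κ) θ := by
    intro θ
    refine (hasDerivAt_integral_of_dominated_loc_of_deriv_le (s := Set.univ)
      (F := fun θ w => F (Z θ w)) (F' := fun θ w => DF (Z θ w) (Z' θ w))
      (bound := fun w => C * ((‖X‖ + ‖Y‖) * ‖w‖)) Filter.univ_mem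
      (Filter.Eventually.of_forall fun θ => (hZint θ).aestronglyMeasurable) (hZint θ) ?_
      (ae_of_all _ fun w θ _ => hbound θ w)
      ((integrable_norm_gaussianPi.const_mul _).const_mul _)
      (ae_of_all _ fun w θ _ => ?_)).2
    · exact ((hDFc.comp (Z θ).continuous).clm_apply (Z' θ).continuous).aestronglyMeasurable
    · have hz : HasDerivAt (fun θ => Z θ w) (Z' θ w) θ := by
        have := ((Real.hasDerivAt_sin θ).smul_const (X w)).add
          ((Real.hasDerivAt_cos θ).smul_const (Y w))
        refine this.congr_deriv ?_
        simp [hZ', sub_eq_add_neg]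
      exact (hF _).comp_hasDerivAt θ hz
  have hsingle : ∀ (L : (κ → ℝ) →L[ℝ] H) (w : κ → ℝ), L w = ∑ i, w i • L (Pi.single i 1) := by
    intro L w
    conv_lhs => rw [pi_eq_sum_univ' w]
    simp [map_sum]
  have hval : ∀ θ, ∫ w, DF (Z θ w) (Z' θ w) ∂gaussianPi κ =
      ∫ w, ∑ i, D2F (Z θ w) (Z θ (Pi.single i 1)) (Z' θ (Pi.single i 1)) ∂gaussianPi κ := by
    intro θ
    choose K hK using fun i => hC2 (Z θ (Pi.single i 1)) (Z' θ (Pi.single i 1))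
    have hm1 : ∀ i : κ, Continuous fun w => DF (Z θ w) (Z' θ (Pi.single i 1)) := fun i =>
      (hDFc.comp (Z θ).continuous).clm_apply continuous_const
    have hm2 : ∀ i : κ, Continuous fun w =>
      D2F (Z θ w) (Z θ (Pi.single i 1)) (Z' θ (Pi.single i 1)) := fun i =>
      (hD2c _ _).comp (Z θ).continuous
    rw [integral_finsetSum _ fun i _ => Integrable.of_bound (hm2 i).aestronglyMeasurable (K i)
      (ae_of_all _ fun w => hK i _)]
    have h1 : ∀ w, DF (Z θ w) (Z' θ w) = ∑ i, w i * DF (Z θ w) (Z' θ (Pi.single i 1)) := by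
      intro w
      conv_lhs => rw [hsingle (Z' θ) w]
      simp
    simp_rw [h1]
    rw [integral_finsetSum _ fun i _ => (integrable_eval_gaussianPi i).mul_bdd
      (c := C * ‖Z' θ (Pi.single i 1)‖) (hm1 i).aestronglyMeasurable (ae_of_all _ fun w => hC _ _)]
    refine Finset.sum_congr rfl fun i _ => ?_
    refine integral_eval_mul_gaussianPi (C := max (C * ‖Z' θ (Pi.single i 1)‖) (K i)) i
      (fun w => ?_) (hm1 i).measurable (hm2 i).measurable
      (fun w => (hC _ _).trans (le_max_left _ _)) (fun w => (hK i _).trans (le_max_right _ _))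
    have hupd : ∀ t, Z θ (Function.update w i t) = Z θ w + (t - w i) • Z θ (Pi.single i 1) := by
      intro t
      rw [← map_smul, ← map_add]
      congr 1
      ext j
      by_cases hj : j = i
      · subst hj; simp
      · simp [hj]
    simp_rw [hupd]
    have h2 := hDF (Z θ w) (Z θ (Pi.single i 1)) (Z' θ (Pi.single i 1))
    have h3 : HasDerivAt (fun t : ℝ => t - w i) 1 (w i) := (hasDerivAt_id _).sub_const _
    have := h2.comp_of_eq (w i) h3 (sub_self _).symm
    simpa [Function.comp_def] using this
  have hmono : MonotoneOn (fun θ => ∫ w, F (Z θ w) ∂gaussianPi κ) (Set.Icc 0 (Real.pi / 2)) := by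
    refine monotoneOn_of_deriv_nonneg (convex_Icc _ _)
      (fun θ _ => (hderiv θ).continuousAt.continuousWithinAt)
      (fun θ _ => (hderiv θ).differentiableAt.differentiableWithinAt) fun θ hθ => ?_
    rw [(hderiv θ).deriv, hval]
    rw [interior_Icc] at hθ
    exact integral_nonneg fun w => hpos θ hθ _
  have := hmono (Set.left_mem_Icc.2 (by positivity)) (Set.right_mem_Icc.2 (by positivity))
    (by positivity)
  exact ⟨by simpa [hZ] using hZint 0, by simpa [hZ] using hZint (Real.pi / 2),
    by simpa [hZ] using this⟩

end Interpolation

/-! ### Soft minima -/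

section SoftMin

variable {ι : Type*} [Fintype ι]

/-- The soft minimum `-β⁻¹ log ∑ exp (-β y_a)`. -/
noncomputable def softMin (β : ℝ) (y : ι → ℝ) : ℝ :=
  -β⁻¹ * Real.log (∑ a, Real.exp (-β * y a))

/-- The Gibbs weights `exp (-β y_a) / ∑ exp (-β y_b)`, the partial derivatives of `softMin`. -/
noncomputable def gibbsWeight (β : ℝ) (y : ι → ℝ) (a : ι) : ℝ :=
  Real.exp (-β * y a) / ∑ b, Real.exp (-β * y b)

theorem gibbsWeight_nonneg (β : ℝ) (y : ι → ℝ) (a : ι) : 0 ≤ gibbsWeight β y a := by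
  unfold gibbsWeight; positivity

variable [Nonempty ι]

theorem sum_exp_pos (β : ℝ) (y : ι → ℝ) : 0 < ∑ a, Real.exp (-β * y a) :=
  Finset.sum_pos (fun _ _ => Real.exp_pos _) Finset.univ_nonempty

theorem sum_gibbsWeight (β : ℝ) (y : ι → ℝ) : ∑ a, gibbsWeight β y a = 1 := by
  unfold gibbsWeight
  rw [← Finset.sum_div, div_self (sum_exp_pos β y).ne']

theorem softMin_le {β : ℝ} (hβ : 0 < β) (y : ι → ℝ) (a : ι) : softMin β y ≤ y a := by
  have h : -β * y a ≤ Real.log (∑ a, Real.exp (-β * y a)) := by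
    rw [Real.le_log_iff_exp_le (sum_exp_pos β y)]
    exact Finset.single_le_sum (f := fun a => Real.exp (-β * y a)) (fun _ _ => (Real.exp_pos _).le)
      (Finset.mem_univ a)
  have h2 := mul_le_mul_of_nonneg_left h (inv_pos.2 hβ).le
  have h3 : β⁻¹ * (-β * y a) = -y a := by field_simp
  unfold softMin
  linarith

theorem le_softMin {β m : ℝ} (hβ : 0 < β) (y : ι → ℝ) (h : ∀ a, m ≤ y a) :
    m - Real.log (Fintype.card ι) / β ≤ softMin β y := by
  have h1 : ∑ a, Real.exp (-β * y a) ≤ Fintype.card ι * Real.exp (-β * m) := by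
    calc ∑ a, Real.exp (-β * y a) ≤ ∑ _a : ι, Real.exp (-β * m) :=
          Finset.sum_le_sum fun a _ => Real.exp_le_exp.2 (by have := h a; nlinarith)
      _ = _ := by simp
  have h2 := Real.log_le_log (sum_exp_pos β y) h1
  rw [Real.log_mul (by simp) (Real.exp_pos _).ne', Real.log_exp] at h2
  have h3 := mul_le_mul_of_nonneg_left h2 (inv_pos.2 hβ).le
  have h4 : β⁻¹ * (Real.log (Fintype.card ι) + -β * m) = Real.log (Fintype.card ι) / β - m := by
    field_simp; ring
  unfold softMin
  linarith

theorem hasDerivAt_gibbsWeight {β : ℝ} {y : ℝ → ι → ℝ} {y' : ι → ℝ} {t : ℝ}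
    (hy : ∀ a, HasDerivAt (fun t => y t a) (y' a) t) (a : ι) :
    HasDerivAt (fun t => gibbsWeight β (y t) a)
      (-β * gibbsWeight β (y t) a * (y' a - ∑ b, gibbsWeight β (y t) b * y' b)) t := by
  have he : ∀ b, HasDerivAt (fun t => Real.exp (-β * y t b))
      (Real.exp (-β * y t b) * (-β * y' b)) t := fun b => ((hy b).const_mul (-β)).exp
  have hs := HasDerivAt.fun_sum (u := Finset.univ) fun b _ => he b
  have hp := (sum_exp_pos β (y t)).ne'
  refine ((he a).div hs hp).congr_deriv ?_
  have e1 : ∑ b, gibbsWeight β (y t) b * y' b =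
      (∑ b, Real.exp (-β * y t b) * y' b) / ∑ b, Real.exp (-β * y t b) := by
    rw [Finset.sum_div]
    exact Finset.sum_congr rfl fun b _ => by unfold gibbsWeight; ring
  have e2 : ∑ b, Real.exp (-β * y t b) * (-β * y' b) =
      -β * ∑ b, Real.exp (-β * y t b) * y' b := by
    rw [Finset.mul_sum]
    exact Finset.sum_congr rfl fun b _ => by ring
  rw [e1, e2]
  unfold gibbsWeight
  field_simp
  ring

theorem hasFDerivAt_softMin_comp {H : Type*} [NormedAddCommGroup H] [NormedSpace ℝ H] {β : ℝ}
    (hβ : 0 < β) {φ : ι → H → ℝ} {φ' : ι → H →L[ℝ] ℝ} {x : H}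
    (h : ∀ a, HasFDerivAt (φ a) (φ' a) x) :
    HasFDerivAt (fun x => softMin β fun a => φ a x)
      (∑ a, gibbsWeight β (fun a => φ a x) a • φ' a) x := by
  have he : ∀ b, HasFDerivAt (fun x => Real.exp (-β * φ b x))
      (Real.exp (-β * φ b x) • (-β) • φ' b) x := fun b => ((h b).const_mul (-β)).exp
  have hs := HasFDerivAt.fun_sum (u := Finset.univ) fun b _ => he b
  have hp := (sum_exp_pos β (fun a => φ a x)).ne'
  refine ((hs.log hp).const_mul (-β⁻¹)).congr_fderiv ?_
  rw [Finset.smul_sum, Finset.smul_sum]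
  refine Finset.sum_congr rfl fun b _ => ?_
  unfold gibbsWeight
  rw [smul_smul, smul_smul, smul_smul]
  congr 1
  field_simp

end SoftMin

/-! ### Gordon's comparison inequality -/

section Gordon

variable {n T : ℕ}

/-- The `n × T` matrix with entries `w (i, t)`, as an operator between Euclidean spaces. -/
noncomputable def matrixOp (n T : ℕ) : (Fin n × Fin T → ℝ) →L[ℝ]
    (EuclideanSpace ℝ (Fin T) →L[ℝ] EuclideanSpace ℝ (Fin n)) :=
  LinearMap.toContinuousLinearMap
    { toFun := fun w => LinearMap.toContinuousLinearMap
        (Matrix.toEuclideanLin (Matrix.of fun i t => w (i, t)))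
      map_add' := fun v w => by
        rw [← map_add, ← map_add]; rfl
      map_smul' := fun c w => by
        rw [RingHom.id_apply, ← map_smul, ← map_smul]; rfl }

theorem matrixOp_apply (w : Fin n × Fin T → ℝ) (u : EuclideanSpace ℝ (Fin T)) (i : Fin n) :
    matrixOp n T w u i = ∑ t, w (i, t) * u t := by
  simp [matrixOp, Matrix.toLpLin_apply, Matrix.mulVec, dotProduct]

/-- The index set of the Gaussian coordinates `(G, z, g, h)` which enter the comparison: a matrix
`G` and a scalar `z` for one process, and vectors `g`, `h` for the other. -/
abbrev GordonIndex (n T : ℕ) : Type := (Fin n × Fin T) ⊕ Unit ⊕ Fin n ⊕ Fin T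

/-- The process `u ↦ (G u, z)`. -/
noncomputable def gordonX {ι : Type*} [Fintype ι] (u : ι → EuclideanSpace ℝ (Fin T)) :
    (GordonIndex n T → ℝ) →L[ℝ] (ι → EuclideanSpace ℝ (Fin n) × ℝ) :=
  LinearMap.toContinuousLinearMap
    { toFun := fun w a => (matrixOp n T (fun p => w (.inl p)) (u a), w (.inr (.inl ())))
      map_add' := fun v w => by
        ext a
        · simp [matrixOp_apply, add_mul, Finset.sum_add_distrib]
        · simp
      map_smul' := fun c w => by
        ext a
        · simp [matrixOp_apply, mul_assoc, Finset.mul_sum]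
        · simp }

/-- The process `u ↦ (g, ⟨h, u⟩)`. -/
noncomputable def gordonY {ι : Type*} [Fintype ι] (u : ι → EuclideanSpace ℝ (Fin T)) :
    (GordonIndex n T → ℝ) →L[ℝ] (ι → EuclideanSpace ℝ (Fin n) × ℝ) :=
  LinearMap.toContinuousLinearMap
    { toFun := fun w a => (WithLp.toLp 2 fun i => w (.inr (.inr (.inl i))),
        ∑ t, w (.inr (.inr (.inr t))) * u a t)
      map_add' := fun v w => by
        ext a
        · simp
        · simp [add_mul, Finset.sum_add_distrib]
      map_smul' := fun c w => by
        ext a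
        · simp
        · simp [mul_assoc, Finset.mul_sum] }

variable {ι : Type*} [Fintype ι]

theorem gordonX_apply (u : ι → EuclideanSpace ℝ (Fin T)) (w : GordonIndex n T → ℝ) (a : ι) :
    gordonX u w a = (matrixOp n T (fun p => w (.inl p)) (u a), w (.inr (.inl ()))) := rfl

theorem gordonY_apply (u : ι → EuclideanSpace ℝ (Fin T)) (w : GordonIndex n T → ℝ) (a : ι) :
    gordonY u w a = (WithLp.toLp 2 fun i => w (.inr (.inr (.inl i))),
        ∑ t, w (.inr (.inr (.inr t))) * u a t) := rfl

theorem gordonX_inl (u : ι → EuclideanSpace ℝ (Fin T)) (p : Fin n × Fin T) (a : ι) :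
    gordonX (n := n) u (Pi.single (.inl p) 1) a = (u a p.2 • EuclideanSpace.single p.1 1, 0) := by
  rw [gordonX_apply]
  ext i
  · rw [matrixOp_apply]
    by_cases hi : i = p.1
    · rw [Finset.sum_eq_single p.2]
      · subst hi; simp
      · intro b _ hb
        have : (i, b) ≠ p := fun h => hb (by rw [← h])
        simp [this]
      · simp
    · rw [Finset.sum_eq_zero]
      · simp [hi]
      · intro b _
        have : (i, b) ≠ p := fun h => hi (by rw [← h])
        simp [this]
  · simp

theorem gordonX_unit (u : ι → EuclideanSpace ℝ (Fin T)) (a : ι) :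
    gordonX (n := n) u (Pi.single (.inr (.inl ())) 1) a = (0, 1) := by
  rw [gordonX_apply]
  ext i
  · rw [matrixOp_apply]; simp
  · simp

theorem gordonX_inr_inr (u : ι → EuclideanSpace ℝ (Fin T)) (q : Fin n ⊕ Fin T) (a : ι) :
    gordonX (n := n) u (Pi.single (.inr (.inr q)) 1) a = 0 := by
  rw [gordonX_apply]
  ext i
  · rw [matrixOp_apply]; simp
  · simp

theorem gordonY_inl (u : ι → EuclideanSpace ℝ (Fin T)) (p : Fin n × Fin T) (a : ι) :
    gordonY (n := n) u (Pi.single (.inl p) 1) a = 0 := by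
  rw [gordonY_apply]
  ext i <;> simp

theorem gordonY_unit (u : ι → EuclideanSpace ℝ (Fin T)) (a : ι) :
    gordonY (n := n) u (Pi.single (.inr (.inl ())) 1) a = 0 := by
  rw [gordonY_apply]
  ext i <;> simp

theorem gordonY_left (u : ι → EuclideanSpace ℝ (Fin T)) (i : Fin n) (a : ι) :
    gordonY (n := n) u (Pi.single (.inr (.inr (.inl i))) 1) a = (EuclideanSpace.single i 1, 0) := by
  rw [gordonY_apply]
  ext j
  · simp [Pi.single_apply]
  · simp

theorem gordonY_right (u : ι → EuclideanSpace ℝ (Fin T)) (t : Fin T) (a : ι) :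
    gordonY (n := n) u (Pi.single (.inr (.inr (.inr t))) 1) a = (0, u a t) := by
  rw [gordonY_apply]
  ext j
  · simp
  · simp [Pi.single_apply]

/-- The Cauchy-Schwarz inequality for two functionals of norm at most `1`. -/
theorem sum_apply_single_mul_le_one {f g : EuclideanSpace ℝ (Fin n) →L[ℝ] ℝ} (hf : ‖f‖ ≤ 1)
    (hg : ‖g‖ ≤ 1) : ∑ i, f (EuclideanSpace.single i 1) * g (EuclideanSpace.single i 1) ≤ 1 := by
  set x : EuclideanSpace ℝ (Fin n) := ∑ i, g (EuclideanSpace.single i 1) • EuclideanSpace.single i 1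
    with hx
  have hxi : ∀ i, x i = g (EuclideanSpace.single i 1) := fun i => by
    simp [hx, Pi.single_apply]
  have hsum : ∀ k : EuclideanSpace ℝ (Fin n) →L[ℝ] ℝ,
      k x = ∑ i, k (EuclideanSpace.single i 1) * g (EuclideanSpace.single i 1) := fun k => by
    simp [hx, mul_comm]
  have h1 : ‖x‖ ^ 2 = g x := by
    rw [hsum, EuclideanSpace.norm_sq_eq]
    refine Finset.sum_congr rfl fun i _ => ?_
    rw [hxi, Real.norm_eq_abs, sq_abs, sq]
  have h2 : g x ≤ ‖x‖ := (le_abs_self _).trans (by simpa using g.le_of_opNorm_le hg x)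
  have h3 : ‖x‖ ≤ 1 := by
    by_contra h
    push Not at h
    nlinarith
  rw [← hsum]
  exact ((le_abs_self _).trans (by simpa using f.le_of_opNorm_le hf x)).trans h3

end Gordon

section GordonFinite

variable {n T : ℕ} {ι : Type*} [Fintype ι]

/-- Contraction of a bilinear form along the interpolation, with `s = sin θ` and `c = cos θ`. It
vanishes for `u a = u b` a unit vector. -/
theorem sum_gordon_contraction
    (B : (EuclideanSpace ℝ (Fin n) × ℝ) →ₗ[ℝ] (EuclideanSpace ℝ (Fin n) × ℝ) →ₗ[ℝ] ℝ)
    (u : ι → EuclideanSpace ℝ (Fin T)) (a b : ι) (c s : ℝ) :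
    ∑ i : GordonIndex n T,
      B ((s • gordonX u (Pi.single i 1) + c • gordonY u (Pi.single i 1)) a)
        ((c • gordonX u (Pi.single i 1) - s • gordonY u (Pi.single i 1)) b) =
      s * c * ((1 - ∑ t, u a t * u b t) *
        (B (0, 1) (0, 1) - ∑ i, B (EuclideanSpace.single i 1, 0) (EuclideanSpace.single i 1, 0))) := by
  have hl : ∀ (r : ℝ) (i : Fin n), ((r • EuclideanSpace.single i (1 : ℝ), (0 : ℝ)) :
      EuclideanSpace ℝ (Fin n) × ℝ) = r • (EuclideanSpace.single i 1, 0) := fun r i => by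
    ext <;> simp
  have hr : ∀ r : ℝ, ((0, r) : EuclideanSpace ℝ (Fin n) × ℝ) = r • (0, 1) := fun r => by
    ext <;> simp
  simp only [Fintype.sum_sum_type, Pi.add_apply, Pi.sub_apply, Pi.smul_apply, gordonX_inl,
    gordonX_unit, gordonX_inr_inr, gordonY_inl, gordonY_unit, gordonY_left, gordonY_right,
    smul_zero, add_zero, zero_add, sub_zero, zero_sub, Fintype.sum_prod_type, hl,
    Finset.univ_unique, Finset.sum_singleton, PUnit.default_eq_unit]
  simp only [hr (u _ _), map_smul, map_neg, LinearMap.smul_apply, smul_eq_mul]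
  have e1 : ∀ i : Fin n, ∑ t, c * (u b t * (s * (u a t *
      B (EuclideanSpace.single i 1, 0) (EuclideanSpace.single i 1, 0)))) =
      s * c * (∑ t, u a t * u b t) *
        B (EuclideanSpace.single i 1, 0) (EuclideanSpace.single i 1, 0) := fun i => by
    rw [Finset.mul_sum, Finset.sum_mul]
    exact Finset.sum_congr rfl fun t _ => by ring
  have e2 : ∑ t, -(s * (u b t * (c * (u a t * B (0, 1) (0, 1))))) =
      - (s * c * (∑ t, u a t * u b t) * B (0, 1) (0, 1)) := by
    rw [Finset.mul_sum, Finset.sum_mul, ← Finset.sum_neg_distrib]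
    exact Finset.sum_congr rfl fun t _ => by ring
  have e3 : ∑ i : Fin n, -(s * (c * B (EuclideanSpace.single i 1, 0)
      (EuclideanSpace.single i 1, 0))) =
      - (s * c * ∑ i, B (EuclideanSpace.single i 1, 0) (EuclideanSpace.single i 1, 0)) := by
    rw [Finset.mul_sum, ← Finset.sum_neg_distrib]
    exact Finset.sum_congr rfl fun t _ => by ring
  rw [Finset.sum_congr rfl fun i _ => e1 i, e2, e3, ← Finset.mul_sum]
  ring

variable [Nonempty ι]

/-- Gordon's comparison for soft minima over finitely many unit vectors `u a`: for a `C²` function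
`N` with gradient bounded by `1`, the soft minimum of `N (G u) + z` dominates in expectation that of
`N g + ⟨h, u⟩`. The second derivatives of `N` cancel in the interpolation since both processes have
the same variances; what remains is a combination of the mixed derivatives of the soft minimum,
which are nonnegative, with coefficients `(1 - ⟨u, u'⟩) (1 - ⟨∇N, ∇'N⟩) ≥ 0`. -/
theorem integral_softMin_gordon {N : EuclideanSpace ℝ (Fin n) → ℝ} (hN : ContDiff ℝ 2 N)
    (hN1 : ∀ y, ‖fderiv ℝ N y‖ ≤ 1) {K : ℝ} (hN2 : ∀ y, ‖fderiv ℝ (fderiv ℝ N) y‖ ≤ K)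
    (u : ι → EuclideanSpace ℝ (Fin T)) (hu : ∀ a, ‖u a‖ = 1) {β : ℝ} (hβ : 0 < β) :
    Integrable (fun w => softMin β (fun a => N (gordonY u w a).1 + (gordonY u w a).2))
        (gaussianPi (GordonIndex n T)) ∧
      Integrable (fun w => softMin β (fun a => N (gordonX u w a).1 + (gordonX u w a).2))
        (gaussianPi (GordonIndex n T)) ∧
      ∫ w, softMin β (fun a => N (gordonY u w a).1 + (gordonY u w a).2)
          ∂gaussianPi (GordonIndex n T) ≤
        ∫ w, softMin β (fun a => N (gordonX u w a).1 + (gordonX u w a).2)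
          ∂gaussianPi (GordonIndex n T) := by
  have hNd : Differentiable ℝ N := hN.differentiable (by norm_num)
  have hN' : ContDiff ℝ 1 (fderiv ℝ N) := hN.fderiv_right (by norm_num)
  have hNd' : Differentiable ℝ (fderiv ℝ N) := hN'.differentiable (by norm_num)
  have hNc'' : Continuous (fderiv ℝ (fderiv ℝ N)) := hN'.continuous_fderiv (by norm_num)
  let V := EuclideanSpace ℝ (Fin n)
  let H := ι → V × ℝ
  let φ : ι → H → ℝ := fun a x => N (x a).1 + (x a).2
  let d : V → (V × ℝ) →L[ℝ] ℝ := fun y =>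
    (fderiv ℝ N y) ∘L ContinuousLinearMap.fst ℝ V ℝ + ContinuousLinearMap.snd ℝ V ℝ
  let φ' : ι → H → H →L[ℝ] ℝ := fun a x =>
    d (x a).1 ∘L ContinuousLinearMap.proj (φ := fun _ : ι => V × ℝ) a
  have hφ : ∀ a x, HasFDerivAt (φ a) (φ' a x) x := by
    intro a x
    have hp : HasFDerivAt (fun x : H => x a)
      (ContinuousLinearMap.proj (R := ℝ) (φ := fun _ : ι => V × ℝ) a) x :=
      (ContinuousLinearMap.proj (R := ℝ) (φ := fun _ : ι => V × ℝ) a).hasFDerivAt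
    have hN1 : HasFDerivAt (fun x : V × ℝ => N x.1 + x.2) (d (x a).1) (x a) :=
      ((hNd _).hasFDerivAt.comp (x a) hasFDerivAt_fst).add hasFDerivAt_snd
    exact hN1.comp x hp
  let p : H → ι → ℝ := fun x => gibbsWeight β fun a => φ a x
  let D2 : H → H → H → ℝ := fun x v b => ∑ a,
    (-β * p x a * (φ' a x v - ∑ c, p x c * φ' c x v) * φ' a x b +
      p x a * fderiv ℝ (fderiv ℝ N) (x a).1 (v a).1 (b a).1)
  have hφc : ∀ a, Continuous (φ a) := fun a =>
    continuous_iff_continuousAt.2 fun x => (hφ a x).continuousAt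
  have hpc : ∀ a, Continuous fun x => p x a := by
    intro a
    refine Continuous.div ?_ ?_ fun x => (sum_exp_pos β _).ne'
    · exact Real.continuous_exp.comp ((hφc a).const_smul (-β))
    · exact continuous_finsetSum _ fun b _ => Real.continuous_exp.comp ((hφc b).const_smul (-β))
  have hx1 : ∀ a, Continuous fun x : H => (x a).1 := fun a => by fun_prop
  have hφ'c : ∀ a, Continuous (φ' a) := fun a =>
    ((((hN'.continuous.comp (hx1 a)).clm_comp continuous_const).add continuous_const).clm_comp
      continuous_const)
  have hφ'b : ∀ a x b, |φ' a x b| ≤ 2 * ‖b‖ := by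
    intro a x b
    have h1 : |fderiv ℝ N (x a).1 (b a).1| ≤ ‖(b a).1‖ := by
      simpa using (fderiv ℝ N (x a).1).le_of_opNorm_le (hN1 _) (b a).1
    have h2 : ‖(b a).1‖ ≤ ‖b‖ := (norm_fst_le (b a)).trans (norm_le_pi_norm b a)
    have h3 : |(b a).2| ≤ ‖b‖ := (norm_snd_le (b a)).trans (norm_le_pi_norm b a)
    calc |φ' a x b| ≤ |fderiv ℝ N (x a).1 (b a).1| + |(b a).2| := abs_add_le _ _
      _ ≤ _ := by linarith
  have hp0 : ∀ x a, 0 ≤ p x a := fun x a => gibbsWeight_nonneg _ _ _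
  have hp1 : ∀ x, ∑ a, p x a = 1 := fun x => sum_gibbsWeight _ _
  have hple : ∀ x a, p x a ≤ 1 := fun x a => by
    rw [← hp1 x]; exact Finset.single_le_sum (fun b _ => hp0 x b) (Finset.mem_univ a)
  have hK : 0 ≤ K := le_trans (norm_nonneg (fderiv ℝ (fderiv ℝ N) 0)) (hN2 0)
  have hmean : ∀ (x : H) (f : ι → ℝ) (m : ℝ), (∀ a, |f a| ≤ m) → |∑ a, p x a * f a| ≤ m := by
    intro x f m hf
    calc |∑ a, p x a * f a| ≤ ∑ a, |p x a * f a| := Finset.abs_sum_le_sum_abs _ _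
      _ ≤ ∑ a, p x a * m := Finset.sum_le_sum fun a _ => by
          rw [abs_mul, abs_of_nonneg (hp0 x a)]
          exact mul_le_mul_of_nonneg_left (hf a) (hp0 x a)
      _ = m := by rw [← Finset.sum_mul, hp1, one_mul]
  refine integral_gaussianPi_le_of_interpolation (gordonX u) (gordonY u)
    (F := fun x => softMin β fun a => φ a x) (DF := fun x => ∑ a, p x a • φ' a x) (D2F := D2)
    (C := 2) zero_le_two (fun x => hasFDerivAt_softMin_comp hβ fun a => hφ a x) ?_ ?_ ?_ ?_ ?_ ?_
  · intro x v b
    have hl : HasDerivAt (fun t : ℝ => x + t • v) v 0 := by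
      simpa using ((hasDerivAt_id (0 : ℝ)).smul_const v).const_add x
    have hφl : ∀ a, HasDerivAt (fun t : ℝ => φ a (x + t • v)) (φ' a x v) 0 := fun a => by
      have h0 : HasFDerivAt (φ a) (φ' a x) (x + (0 : ℝ) • v) := by
        rw [zero_smul, add_zero]; exact hφ a x
      exact h0.comp_hasDerivAt (0 : ℝ) hl
    have hpl := fun a => hasDerivAt_gibbsWeight (β := β) (y := fun t a => φ a (x + t • v)) hφl a
    have hφ'l : ∀ a, HasDerivAt (fun t : ℝ => φ' a (x + t • v) b)
        (fderiv ℝ (fderiv ℝ N) (x a).1 (v a).1 (b a).1) 0 := by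
      intro a
      have h1 : HasDerivAt (fun t : ℝ => ((x + t • v) a).1) (v a).1 0 := by
        have : HasDerivAt (fun t : ℝ => (x a).1 + t • (v a).1) (v a).1 0 := by
          simpa using ((hasDerivAt_id (0 : ℝ)).smul_const (v a).1).const_add (x a).1
        exact this
      have h2 := (hNd' ((x + (0 : ℝ) • v) a).1).hasFDerivAt.comp_hasDerivAt (0 : ℝ) h1
      have h3 := (h2.clm_apply (hasDerivAt_const (0 : ℝ) (b a).1)).add_const (b a).2
      refine h3.congr_deriv ?_
      simp
    have := HasDerivAt.fun_sum (u := Finset.univ) fun a _ => (hpl a).mul (hφ'l a)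
    simpa [D2, p] using this
  · exact continuous_finsetSum _ fun a _ => (hpc a).smul (hφ'c a)
  · intro v b
    have h1 : ∀ a v, Continuous fun x => φ' a x v := fun a v => (hφ'c a).clm_apply continuous_const
    refine continuous_finsetSum _ fun a _ => ((((continuous_const.mul (hpc a)).mul ((h1 a v).sub
      (continuous_finsetSum _ fun c _ => (hpc c).mul (h1 c v)))).mul (h1 a b)).add
      ((hpc a).mul ?_))
    exact ((hNc''.comp (hx1 a)).clm_apply continuous_const).clm_apply continuous_const
  · intro x b
    simpa using hmean x (fun a => φ' a x b) (2 * ‖b‖) fun a => hφ'b a x b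
  · intro v b
    refine ⟨∑ a : ι, (β * (4 * ‖v‖) * (2 * ‖b‖) + K * ‖(v a).1‖ * ‖(b a).1‖), fun x => ?_⟩
    refine (Finset.abs_sum_le_sum_abs _ _).trans (Finset.sum_le_sum fun a _ => ?_)
    refine (abs_add_le _ _).trans (add_le_add ?_ ?_)
    · have h1 : |φ' a x v - ∑ c, p x c * φ' c x v| ≤ 4 * ‖v‖ := by
        have := abs_sub (φ' a x v) (∑ c, p x c * φ' c x v)
        have h2 := hφ'b a x v
        have h3 := hmean x (fun c => φ' c x v) (2 * ‖v‖) fun c => hφ'b c x v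
        linarith
      have h2 : |-β * p x a| ≤ β := by
        rw [abs_mul, abs_neg, abs_of_pos hβ, abs_of_nonneg (hp0 x a)]
        exact mul_le_of_le_one_right hβ.le (hple x a)
      rw [abs_mul, abs_mul]
      gcongr
      exact hφ'b a x b
    · rw [abs_mul, abs_of_nonneg (hp0 x a)]
      refine (mul_le_of_le_one_left (abs_nonneg _) (hple x a)).trans ?_
      refine ((fderiv ℝ (fderiv ℝ N) (x a).1 (v a).1).le_opNorm (b a).1).trans ?_
      gcongr
      exact (fderiv ℝ (fderiv ℝ N) (x a).1).le_of_opNorm_le (hN2 _) _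
  · intro θ hθ x
    have hsin : 0 ≤ Real.sin θ := Real.sin_nonneg_of_nonneg_of_le_pi hθ.1.le
      (by linarith [hθ.2, Real.pi_pos])
    have hcos : 0 ≤ Real.cos θ := Real.cos_nonneg_of_neg_pi_div_two_le_of_le
      (by linarith [hθ.1, Real.pi_pos]) hθ.2.le
    have huu : ∀ a, ∑ t, u a t * u a t = 1 := fun a => by
      have := EuclideanSpace.norm_sq_eq (u a)
      rw [hu, one_pow] at this
      rw [this]
      exact Finset.sum_congr rfl fun t _ => by rw [Real.norm_eq_abs, sq_abs, sq]
    have huv : ∀ a b, ∑ t, u a t * u b t ≤ 1 := fun a b => by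
      have := real_inner_le_norm (u b) (u a)
      rw [hu, hu, PiLp.inner_apply] at this
      simpa using this
    set v : GordonIndex n T → H := fun i => Real.sin θ • gordonX u (Pi.single i 1) +
      Real.cos θ • gordonY u (Pi.single i 1) with hv
    set b : GordonIndex n T → H := fun i => Real.cos θ • gordonX u (Pi.single i 1) -
      Real.sin θ • gordonY u (Pi.single i 1) with hb
    set S : ι → ι → ℝ := fun c a => ∑ i, φ' c x (v i) * φ' a x (b i) with hS
    have hSval : ∀ c a, S c a = Real.sin θ * Real.cos θ * ((1 - ∑ t, u c t * u a t) *
        (1 - ∑ i, fderiv ℝ N (x c).1 (EuclideanSpace.single i 1) *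
          fderiv ℝ N (x a).1 (EuclideanSpace.single i 1))) := by
      intro c a
      have := sum_gordon_contraction ((LinearMap.mul ℝ ℝ).compl₁₂ (d (x c).1).toLinearMap
        (d (x a).1).toLinearMap) u c a (Real.cos θ) (Real.sin θ)
      refine this.trans ?_
      simp [d]
    have hS0 : ∀ a, S a a = 0 := fun a => by rw [hSval, huu]; simp
    have hSn : ∀ c a, 0 ≤ S c a := fun c a => by
      rw [hSval]
      exact mul_nonneg (mul_nonneg hsin hcos) (mul_nonneg (sub_nonneg.2 (huv c a))
        (sub_nonneg.2 (sum_apply_single_mul_le_one (hN1 _) (hN1 _))))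
    have hQ : ∀ a, ∑ i, fderiv ℝ (fderiv ℝ N) (x a).1 (v i a).1 (b i a).1 = 0 := by
      intro a
      let B : V →ₗ[ℝ] V →ₗ[ℝ] ℝ := (ContinuousLinearMap.coeLM ℝ) ∘ₗ
        (fderiv ℝ (fderiv ℝ N) (x a).1).toLinearMap
      have := sum_gordon_contraction (B.compl₁₂ (LinearMap.fst ℝ V ℝ) (LinearMap.fst ℝ V ℝ))
        u a a (Real.cos θ) (Real.sin θ)
      rw [huu] at this
      refine this.trans ?_
      simp
    have hsum : ∑ i, D2 x (v i) (b i) = β * ∑ a, ∑ c, p x a * p x c * S c a := by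
      have e : ∀ a, ∑ i, (-β * p x a * (φ' a x (v i) - ∑ c, p x c * φ' c x (v i)) * φ' a x (b i) +
          p x a * fderiv ℝ (fderiv ℝ N) (x a).1 (v i a).1 (b i a).1) =
          β * ∑ c, p x a * p x c * S c a := by
        intro a
        rw [Finset.sum_add_distrib, ← Finset.mul_sum, hQ, mul_zero, add_zero]
        have e1 : ∀ i, -β * p x a * (φ' a x (v i) - ∑ c, p x c * φ' c x (v i)) * φ' a x (b i) =
            -β * p x a * (φ' a x (v i) * φ' a x (b i)) +
              ∑ c, β * (p x a * p x c) * (φ' c x (v i) * φ' a x (b i)) := by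
          intro i
          have : ∑ c, β * (p x a * p x c) * (φ' c x (v i) * φ' a x (b i)) =
              β * p x a * φ' a x (b i) * ∑ c, p x c * φ' c x (v i) := by
            rw [Finset.mul_sum]
            exact Finset.sum_congr rfl fun c _ => by ring
          rw [this]; ring
        rw [Finset.sum_congr rfl fun i _ => e1 i, Finset.sum_add_distrib, ← Finset.mul_sum]
        have e2 : ∑ i, φ' a x (v i) * φ' a x (b i) = 0 := hS0 a
        rw [e2, mul_zero, zero_add, Finset.sum_comm, Finset.mul_sum]
        refine Finset.sum_congr rfl fun c _ => ?_
        rw [← Finset.mul_sum, hS]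
        ring
      simp only [D2]
      rw [Finset.sum_comm, Finset.mul_sum]
      exact Finset.sum_congr rfl fun a _ => e a
    change 0 ≤ ∑ i, D2 x (v i) (b i)
    rw [hsum]
    exact mul_nonneg hβ.le (Finset.sum_nonneg fun a _ => Finset.sum_nonneg fun c _ =>
      mul_nonneg (mul_nonneg (hp0 x a) (hp0 x c)) (hSn c a))

end GordonFinite

section GordonSphere

variable {n T : ℕ}

theorem le_of_forall_pos_le_add_mul {a b C : ℝ} (h : ∀ ε : ℝ, 0 < ε → a ≤ b + ε * C) : a ≤ b := by
  refine le_of_forall_pos_le_add fun ε hε => ?_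
  have hC : 0 < |C| + 1 := by positivity
  refine (h (ε / (|C| + 1)) (by positivity)).trans (add_le_add le_rfl ?_)
  rw [div_mul_eq_mul_div, div_le_iff₀ hC]
  exact mul_le_mul_of_nonneg_left ((le_abs_self C).trans (by linarith)) hε.le

theorem measurePreserving_comp_gaussianPi {κ κ' : Type*} [Fintype κ] [Fintype κ'] (f : κ' → κ)
    (hf : Function.Injective f) :
    MeasurePreserving (fun (w : κ → ℝ) (i : κ') => w (f i)) (gaussianPi κ) (gaussianPi κ') := by
  refine ⟨measurable_pi_iff.2 fun i => measurable_pi_apply _, ?_⟩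
  have h : iIndepFun (fun (i : κ) (w : κ → ℝ) => w i) (gaussianPi κ) :=
    iIndepFun_pi (X := fun _ x => x) fun _ => aemeasurable_id
  rw [(iIndepFun_iff_map_fun_eq_pi_map fun i => (measurable_pi_apply _).aemeasurable).1
    (h.precomp hf)]
  congr 1
  ext1 i
  exact (measurePreserving_eval (fun _ : κ => gaussianReal 0 1) (f i)).map_eq

theorem integral_sq_eval_gaussianPi {κ : Type*} [Fintype κ] (i : κ) :
    Integrable (fun w : κ → ℝ => w i ^ 2) (gaussianPi κ) ∧ ∫ w, w i ^ 2 ∂gaussianPi κ = 1 := by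
  have h1 : Integrable (fun x : ℝ => x ^ 2) (gaussianReal 0 1) :=
    (memLp_id_gaussianReal (μ := 0) (v := 1) 2).integrable_sq
  refine ⟨integrable_comp_eval (μ := fun _ : κ => gaussianReal 0 1) (i := i) h1, ?_⟩
  rw [integral_comp_eval (μ := fun _ : κ => gaussianReal 0 1) (i := i) h1.aestronglyMeasurable
    (f := fun x => x ^ 2)]
  have := variance_fun_id_gaussianReal (μ := 0) (v := 1)
  rw [variance_eq_integral measurable_id'.aemeasurable] at this
  simpa using this

theorem integral_eval_gaussianPi {κ : Type*} [Fintype κ] (i : κ) :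
    ∫ w, w i ∂gaussianPi κ = 0 := by
  rw [integral_comp_eval (μ := fun _ : κ => gaussianReal 0 1) (i := i) (f := fun x => x)
    integrable_id_gaussianReal.aestronglyMeasurable]
  exact integral_id_gaussianReal

theorem integrable_norm_toLp_gaussianPi {κ : Type*} [Fintype κ] :
    Integrable (fun w : κ → ℝ => ‖WithLp.toLp 2 w‖) (gaussianPi κ) := by
  have h := (integrable_norm_gaussianPi (κ := κ)).const_mul
    ‖((EuclideanSpace.equiv κ ℝ).symm : (κ → ℝ) →L[ℝ] EuclideanSpace ℝ κ)‖
  refine h.mono' ?_ (ae_of_all _ fun w => ?_)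
  · exact (continuous_norm.comp (EuclideanSpace.equiv κ ℝ).symm.continuous).aestronglyMeasurable
  · rw [norm_norm]
    exact ((EuclideanSpace.equiv κ ℝ).symm : (κ → ℝ) →L[ℝ] EuclideanSpace ℝ κ).le_opNorm w

/-- A nonnegative function with second moment at most `b²` has mean at most `b`. -/
theorem integral_le_of_integral_sq_le {Ω : Type*} [MeasurableSpace Ω] {P : Measure Ω}
    [IsProbabilityMeasure P] {f g : Ω → ℝ} {b : ℝ} (hb : 0 ≤ b) (hf : Integrable f P)
    (hg : Integrable g P) (hfg : ∀ ω, f ω ^ 2 ≤ g ω) (h : ∫ ω, g ω ∂P ≤ b ^ 2) :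
    ∫ ω, f ω ∂P ≤ b := by
  refine abs_le_of_sq_le_sq' ?_ hb |>.2
  refine le_trans ?_ h
  have h1 : ∫ ω, (2 * (∫ ω, f ω ∂P) * f ω - (∫ ω, f ω ∂P) ^ 2) ∂P ≤ ∫ ω, g ω ∂P := by
    refine integral_mono ((hf.const_mul _).sub (integrable_const _)) hg fun ω => ?_
    have := sq_nonneg (f ω - ∫ ω, f ω ∂P)
    have := hfg ω
    dsimp only
    nlinarith
  rw [integral_sub (hf.const_mul _) (integrable_const _), integral_const_mul, integral_const] at h1
  simp only [probReal_univ, one_smul] at h1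
  nlinarith

theorem integral_norm_toLp_gaussianPi_le {κ : Type*} [Fintype κ] :
    ∫ w : κ → ℝ, ‖WithLp.toLp 2 w‖ ∂gaussianPi κ ≤ √(Fintype.card κ) := by
  refine integral_le_of_integral_sq_le (g := fun w => ∑ i, w i ^ 2) (Real.sqrt_nonneg _)
    integrable_norm_toLp_gaussianPi
    (integrable_finsetSum _ fun i _ => (integral_sq_eval_gaussianPi i).1) (fun w => ?_) ?_
  · rw [EuclideanSpace.norm_sq_eq]; simp
  · rw [integral_finsetSum _ fun i _ => (integral_sq_eval_gaussianPi i).1,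
      Real.sq_sqrt (by positivity)]
    simp [(integral_sq_eval_gaussianPi _).2]

theorem integrable_of_lipschitz_gaussianPi {N : EuclideanSpace ℝ (Fin n) → ℝ}
    (hN : ∀ x y, |N x - N y| ≤ ‖x - y‖) :
    Integrable (fun g : Fin n → ℝ => N (WithLp.toLp 2 g)) (gaussianPi (Fin n)) := by
  have hc : Continuous N := by
    refine (LipschitzWith.of_dist_le_mul (K := 1) fun x y => ?_).continuous
    simpa [Real.dist_eq, dist_eq_norm] using hN x y
  refine ((integrable_const |N 0|).add (integrable_norm_toLp_gaussianPi (κ := Fin n))).mono'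
    (hc.comp (EuclideanSpace.equiv (Fin n) ℝ).symm.continuous).aestronglyMeasurable
    (ae_of_all _ fun g => ?_)
  have h1 := hN (WithLp.toLp 2 g) 0
  have h2 := abs_add_le (N 0) (N (WithLp.toLp 2 g) - N 0)
  rw [add_sub_cancel] at h2
  rw [sub_zero] at h1
  simp only [Real.norm_eq_abs, Pi.add_apply]
  linarith

theorem abs_sub_le_of_norm_fderiv_le_one {E : Type*} [NormedAddCommGroup E] [NormedSpace ℝ E]
    {N : E → ℝ} (hN : Differentiable ℝ N) (hN1 : ∀ y, ‖fderiv ℝ N y‖ ≤ 1) (x y : E) :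
    |N x - N y| ≤ ‖x - y‖ := by
  simpa using convex_univ.norm_image_sub_le_of_norm_fderiv_le (𝕜 := ℝ) (C := 1)
    (fun z _ => hN z) (fun z _ => hN1 z) (Set.mem_univ y) (Set.mem_univ x)

/-- Gordon's inequality over finitely many unit vectors. The minimum of `N (G u)` enters only
through an integrable upper bound `m`. -/
theorem gordon_finite {ι : Type*} [Fintype ι] [Nonempty ι]
    {N : EuclideanSpace ℝ (Fin n) → ℝ} (hN : ContDiff ℝ 2 N)
    (hN1 : ∀ y, ‖fderiv ℝ N y‖ ≤ 1) {K : ℝ} (hN2 : ∀ y, ‖fderiv ℝ (fderiv ℝ N) y‖ ≤ K)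
    (u : ι → EuclideanSpace ℝ (Fin T)) (hu : ∀ a, ‖u a‖ = 1) {m : (Fin n × Fin T → ℝ) → ℝ}
    (hm : Integrable m (gaussianPi (Fin n × Fin T)))
    (h : ∀ w, ∃ a, N (matrixOp n T w (u a)) ≤ m w) :
    ∫ g : Fin n → ℝ, N (WithLp.toLp 2 g) ∂gaussianPi (Fin n) - √T ≤
      ∫ w, m w ∂gaussianPi (Fin n × Fin T) := by
  -- The inverse temperature is `ε⁻¹`, so that the soft minimum costs `ε log (card ι)`.
  refine le_of_forall_pos_le_add_mul (C := Real.log (Fintype.card ι)) fun ε hε => ?_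
  obtain ⟨iY, iX, hYX⟩ := integral_softMin_gordon hN hN1 hN2 u hu (inv_pos.2 hε)
  have mpG := measurePreserving_comp_gaussianPi (κ := GordonIndex n T) (κ' := Fin n × Fin T)
    Sum.inl Sum.inl_injective
  have mpg := measurePreserving_comp_gaussianPi (κ := GordonIndex n T) (κ' := Fin n)
    (fun i => .inr (.inr (.inl i))) (fun i j hij => by simpa using hij)
  have mph := measurePreserving_comp_gaussianPi (κ := GordonIndex n T) (κ' := Fin T)
    (fun i => .inr (.inr (.inr i))) (fun i j hij => by simpa using hij)
  have hlip := abs_sub_le_of_norm_fderiv_le_one (hN.differentiable (by norm_num)) hN1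
  have push : ∀ {κ' : Type} [Fintype κ'] {f : (GordonIndex n T → ℝ) → κ' → ℝ},
      MeasurePreserving f (gaussianPi (GordonIndex n T)) (gaussianPi κ') → ∀ {k : (κ' → ℝ) → ℝ},
      Integrable k (gaussianPi κ') → ∫ w, k (f w) ∂gaussianPi (GordonIndex n T) =
        ∫ v, k v ∂gaussianPi κ' := by
    intro κ' _ f hf k hk
    rw [← hf.map_eq, integral_map hf.measurable.aemeasurable]
    rw [hf.map_eq]; exact hk.aestronglyMeasurable
  have ig := integrable_of_lipschitz_gaussianPi hlip
  have ih := integrable_norm_toLp_gaussianPi (κ := Fin T)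
  have hX : ∫ w, softMin ε⁻¹ (fun a => N (gordonX u w a).1 + (gordonX u w a).2)
      ∂gaussianPi (GordonIndex n T) ≤ ∫ w, m w ∂gaussianPi (Fin n × Fin T) := by
    have iz := integrable_eval_gaussianPi (κ := GordonIndex n T) (.inr (.inl ()))
    have im : Integrable (fun w : GordonIndex n T → ℝ => m fun p => w (.inl p))
        (gaussianPi (GordonIndex n T)) := mpG.integrable_comp_of_integrable hm
    calc _ ≤ ∫ w : GordonIndex n T → ℝ, (m (fun p => w (.inl p)) + w (.inr (.inl ())))
          ∂gaussianPi (GordonIndex n T) := by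
          refine integral_mono iX (im.add iz) fun w => ?_
          obtain ⟨a, ha⟩ := h fun p => w (.inl p)
          refine (softMin_le (inv_pos.2 hε) _ a).trans ?_
          rw [gordonX_apply]
          exact add_le_add ha le_rfl
      _ = _ := by
          rw [integral_add im iz, integral_eval_gaussianPi, push mpG hm, add_zero]
  have hY : ∫ g : Fin n → ℝ, N (WithLp.toLp 2 g) ∂gaussianPi (Fin n) - √T -
      ε * Real.log (Fintype.card ι) ≤
      ∫ w, softMin ε⁻¹ (fun a => N (gordonY u w a).1 + (gordonY u w a).2)
        ∂gaussianPi (GordonIndex n T) := by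
    have ig' : Integrable (fun w : GordonIndex n T → ℝ =>
        N (WithLp.toLp 2 fun i => w (.inr (.inr (.inl i))))) (gaussianPi (GordonIndex n T)) :=
      mpg.integrable_comp_of_integrable ig
    have ih' : Integrable (fun w : GordonIndex n T → ℝ =>
        ‖WithLp.toLp 2 fun t => w (.inr (.inr (.inr t)))‖) (gaussianPi (GordonIndex n T)) :=
      mph.integrable_comp_of_integrable ih
    have igh := ig'.sub ih'
    simp only [Pi.sub_def] at igh
    have hle := integral_norm_toLp_gaussianPi_le (κ := Fin T)
    rw [Fintype.card_fin] at hle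
    calc _ ≤ ∫ g : Fin n → ℝ, N (WithLp.toLp 2 g) ∂gaussianPi (Fin n) -
          ∫ w : Fin T → ℝ, ‖WithLp.toLp 2 w‖ ∂gaussianPi (Fin T) -
            ε * Real.log (Fintype.card ι) := by linarith
      _ = ∫ w : GordonIndex n T → ℝ, (N (WithLp.toLp 2 fun i => w (.inr (.inr (.inl i)))) -
          ‖WithLp.toLp 2 fun t => w (.inr (.inr (.inr t)))‖ - ε * Real.log (Fintype.card ι))
            ∂gaussianPi (GordonIndex n T) := by
          rw [integral_sub igh (integrable_const _), integral_sub ig' ih', push mpg ig,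
            push mph ih, integral_const]
          simp
      _ ≤ _ := by
          refine integral_mono ((ig'.sub ih').sub (integrable_const _)) iY fun w => ?_
          refine le_trans (le_of_eq ?_) (le_softMin
            (m := N (WithLp.toLp 2 fun i => w (.inr (.inr (.inl i)))) -
              ‖WithLp.toLp 2 fun t => w (.inr (.inr (.inr t)))‖) (inv_pos.2 hε) _ fun a => ?_)
          · rw [div_inv_eq_mul, mul_comm ε]
          · rw [gordonY_apply, sub_eq_add_neg]
            refine add_le_add le_rfl ?_
            have := abs_real_inner_le_norm (u a) (WithLp.toLp 2 fun t => w (.inr (.inr (.inr t))))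
            rw [hu, one_mul, PiLp.inner_apply] at this
            simpa using (abs_le.1 this).1
  linarith

/-- Gordon's inequality over the unit sphere, from finite nets. -/
theorem gordon_sphere {N : EuclideanSpace ℝ (Fin n) → ℝ} (hN : ContDiff ℝ 2 N)
    (hN1 : ∀ y, ‖fderiv ℝ N y‖ ≤ 1) {K : ℝ} (hN2 : ∀ y, ‖fderiv ℝ (fderiv ℝ N) y‖ ≤ K)
    {m : (Fin n × Fin T → ℝ) → ℝ} (hm : Integrable m (gaussianPi (Fin n × Fin T)))
    (h : ∀ w, ∃ v : EuclideanSpace ℝ (Fin T), ‖v‖ = 1 ∧ N (matrixOp n T w v) ≤ m w) :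
    ∫ g : Fin n → ℝ, N (WithLp.toLp 2 g) ∂gaussianPi (Fin n) - √T ≤
      ∫ w, m w ∂gaussianPi (Fin n × Fin T) := by
  have hlip := abs_sub_le_of_norm_fderiv_le_one (hN.differentiable (by norm_num)) hN1
  have iw := (integrable_norm_gaussianPi (κ := Fin n × Fin T)).const_mul ‖matrixOp n T‖
  refine le_of_forall_pos_le_add_mul
    (C := ∫ w, ‖matrixOp n T‖ * ‖w‖ ∂gaussianPi (Fin n × Fin T)) fun ε hε => ?_
  obtain ⟨t, ht, htf, hcov⟩ :=
    (isCompact_sphere (0 : EuclideanSpace ℝ (Fin T)) 1).finite_cover_balls hε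
  have := htf.fintype
  obtain ⟨v₀, hv₀, -⟩ := h 0
  have hne : ∀ v : EuclideanSpace ℝ (Fin T), ‖v‖ = 1 → ∃ x ∈ t, ‖v - x‖ < ε := fun v hv => by
    have := hcov (mem_sphere_zero_iff_norm.2 hv)
    simpa [dist_eq_norm] using this
  have : Nonempty t := by
    obtain ⟨x, hx, -⟩ := hne v₀ hv₀
    exact ⟨⟨x, hx⟩⟩
  rw [← integral_const_mul, ← integral_add hm (iw.const_mul ε)]
  refine gordon_finite hN hN1 hN2 (fun x : t => (x : EuclideanSpace ℝ (Fin T)))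
    (fun x => mem_sphere_zero_iff_norm.1 (ht x.2)) (hm.add (iw.const_mul ε)) fun w => ?_
  obtain ⟨v, hv, hvm⟩ := h w
  obtain ⟨x, hx, hvx⟩ := hne v hv
  refine ⟨⟨x, hx⟩, ?_⟩
  have h1 := hlip (matrixOp n T w x) (matrixOp n T w v)
  have h2 : ‖matrixOp n T w x - matrixOp n T w v‖ ≤ ‖matrixOp n T‖ * ‖w‖ * ε := by
    rw [← map_sub, ← norm_neg, ← map_neg, neg_sub]
    exact ((matrixOp n T w).le_of_opNorm_le ((matrixOp n T).le_opNorm w) _).trans (by gcongr)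
  have h3 := (abs_le.1 h1).2
  simp only
  linarith

/-- The smooth approximation `√(δ² + ‖L y‖²)` of the seminorm `‖L y‖`. -/
noncomputable def smoothNorm (δ : ℝ)
    (L : EuclideanSpace ℝ (Fin n) →L[ℝ] EuclideanSpace ℝ (Fin n)) (y : EuclideanSpace ℝ (Fin n)) :
    ℝ :=
  √(δ ^ 2 + ‖L y‖ ^ 2)

variable {δ : ℝ} {L : EuclideanSpace ℝ (Fin n) →L[ℝ] EuclideanSpace ℝ (Fin n)}

theorem norm_le_smoothNorm (y : EuclideanSpace ℝ (Fin n)) : ‖L y‖ ≤ smoothNorm δ L y :=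
  Real.le_sqrt_of_sq_le (by nlinarith [sq_nonneg δ])

theorem le_smoothNorm (y : EuclideanSpace ℝ (Fin n)) : δ ≤ smoothNorm δ L y :=
  Real.le_sqrt_of_sq_le (by nlinarith [sq_nonneg ‖L y‖])

theorem smoothNorm_le (hδ : 0 < δ) (y : EuclideanSpace ℝ (Fin n)) :
    smoothNorm δ L y ≤ ‖L y‖ + δ := by
  have := norm_nonneg (L y)
  exact Real.sqrt_le_iff.2 ⟨by positivity, by nlinarith⟩

theorem abs_smoothNorm_sub_le (hδ : 0 < δ)
    (x y : EuclideanSpace ℝ (Fin n)) : |smoothNorm δ L x - smoothNorm δ L y| ≤ ‖L x - L y‖ := by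
  have hx := norm_le_smoothNorm (δ := δ) (L := L) x
  have hy := norm_le_smoothNorm (δ := δ) (L := L) y
  have hx1 := le_smoothNorm (δ := δ) (L := L) x
  have hy1 := le_smoothNorm (δ := δ) (L := L) y
  have h1 : smoothNorm δ L x ^ 2 - smoothNorm δ L y ^ 2 = ‖L x‖ ^ 2 - ‖L y‖ ^ 2 := by
    unfold smoothNorm
    rw [Real.sq_sqrt (by positivity), Real.sq_sqrt (by positivity)]
    ring
  have h2 := abs_norm_sub_norm_le (L x) (L y)
  have h3 : |smoothNorm δ L x - smoothNorm δ L y| * (smoothNorm δ L x + smoothNorm δ L y) ≤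
      ‖L x - L y‖ * (smoothNorm δ L x + smoothNorm δ L y) := by
    calc _ = |smoothNorm δ L x ^ 2 - smoothNorm δ L y ^ 2| := by
          rw [sq_sub_sq, abs_mul, abs_of_pos (by linarith : 0 < smoothNorm δ L x + smoothNorm δ L y)]
          ring
      _ = |‖L x‖ - ‖L y‖| * (‖L x‖ + ‖L y‖) := by
          rw [h1, sq_sub_sq, abs_mul, abs_of_nonneg (by positivity)]; ring
      _ ≤ _ := by gcongr
  exact le_of_mul_le_mul_right h3 (by linarith)

theorem contDiff_smoothNorm (hδ : 0 < δ) : ContDiff ℝ 2 (smoothNorm δ L) := by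
  refine ContDiff.sqrt (contDiff_const.add (L.contDiff.norm_sq ℝ)) fun y => ?_
  positivity

theorem hasFDerivAt_smoothNorm (hδ : 0 < δ) (y : EuclideanSpace ℝ (Fin n)) :
    HasFDerivAt (smoothNorm δ L) ((smoothNorm δ L y)⁻¹ • (innerSL ℝ (L y)).comp L) y := by
  have h1 : HasFDerivAt (fun y => δ ^ 2 + ‖L y‖ ^ 2) (2 • (innerSL ℝ (L y)).comp L) y :=
    (L.hasFDerivAt.norm_sq).const_add _
  refine (h1.sqrt (by positivity)).congr_fderiv ?_
  ext z
  simp only [smoothNorm, _root_.smul_apply, smul_eq_mul, nsmul_eq_mul]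
  simp
  ring

theorem norm_fderiv_fderiv_smoothNorm_le (hδ : 0 < δ) (hL : ∀ y, ‖L y‖ ≤ ‖y‖)
    (y : EuclideanSpace ℝ (Fin n)) :
    ‖fderiv ℝ (fderiv ℝ (smoothNorm δ L)) y‖ ≤ 2 * δ⁻¹ := by
  have hlip : LipschitzWith (Real.toNNReal (2 * δ⁻¹)) (fderiv ℝ (smoothNorm δ L)) := by
    refine LipschitzWith.of_dist_le_mul fun x y => ?_
    rw [Real.coe_toNNReal _ (by positivity), dist_eq_norm, dist_eq_norm,
      (hasFDerivAt_smoothNorm hδ x).fderiv, (hasFDerivAt_smoothNorm hδ y).fderiv]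
    set p := smoothNorm δ L x
    set q := smoothNorm δ L y
    have hp : δ ≤ p := le_smoothNorm x
    have hq : δ ≤ q := le_smoothNorm y
    have hp0 : 0 < p := hδ.trans_le hp
    have hq0 : 0 < q := hδ.trans_le hq
    have hqy : ‖L y‖ ≤ q := norm_le_smoothNorm y
    have hpq : |p - q| ≤ ‖L x - L y‖ := abs_smoothNorm_sub_le hδ x y
    have hxy : ‖L x - L y‖ ≤ ‖x - y‖ := by rw [← map_sub]; exact hL _
    have h1 : ‖p⁻¹ • L x - q⁻¹ • L y‖ ≤ 2 * δ⁻¹ * ‖x - y‖ := by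
      have e : p⁻¹ • L x - q⁻¹ • L y = p⁻¹ • (L x - L y) + (p⁻¹ - q⁻¹) • L y := by
        rw [smul_sub, sub_smul]; abel
      have e2 : p⁻¹ - q⁻¹ = p⁻¹ * q⁻¹ * (q - p) := by field_simp
      have b1 : p⁻¹ ≤ δ⁻¹ := by gcongr
      rw [e]
      refine (norm_add_le _ _).trans ?_
      rw [norm_smul, norm_smul, e2, norm_mul, norm_mul, Real.norm_eq_abs, Real.norm_eq_abs,
        Real.norm_eq_abs, abs_of_pos (inv_pos.2 hp0), abs_of_pos (inv_pos.2 hq0), abs_sub_comm]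
      have b2 : p⁻¹ * q⁻¹ * |p - q| * ‖L y‖ ≤ δ⁻¹ * ‖x - y‖ := by
        calc p⁻¹ * q⁻¹ * |p - q| * ‖L y‖ ≤ p⁻¹ * q⁻¹ * |p - q| * q := by gcongr
          _ = p⁻¹ * |p - q| := by field_simp
          _ ≤ δ⁻¹ * ‖x - y‖ := by gcongr; exact hpq.trans hxy
      have b3 : p⁻¹ * ‖L x - L y‖ ≤ δ⁻¹ * ‖x - y‖ := by gcongr
      linarith
    refine ContinuousLinearMap.opNorm_le_bound _ (by positivity) fun z => ?_
    have e : (p⁻¹ • (innerSL ℝ (L x)).comp L - q⁻¹ • (innerSL ℝ (L y)).comp L) z =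
        inner ℝ (p⁻¹ • L x - q⁻¹ • L y) (L z) := by
      simp [inner_sub_left, inner_smul_left]
    rw [e]
    refine (norm_inner_le_norm _ _).trans ?_
    gcongr
    exact hL z
  have := norm_fderiv_le_of_lipschitz ℝ hlip (x₀ := y)
  rwa [Real.coe_toNNReal _ (by positivity)] at this

/-- Gordon's inequality for a seminorm `‖L ·‖` and its negative: with the sign `1` it bounds the
least value of `‖L (G v)‖` on the unit sphere from below (Gordon), with the sign `-1` the
greatest value from above (Chevet). -/
theorem gordon_norm (hL : ∀ y, ‖L y‖ ≤ ‖y‖) {c : ℝ} (hc : |c| = 1)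
    {m : (Fin n × Fin T → ℝ) → ℝ} (hm : Integrable m (gaussianPi (Fin n × Fin T)))
    (h : ∀ w, ∃ v : EuclideanSpace ℝ (Fin T), ‖v‖ = 1 ∧ c * ‖L (matrixOp n T w v)‖ ≤ m w) :
    c * ∫ g : Fin n → ℝ, ‖L (WithLp.toLp 2 g)‖ ∂gaussianPi (Fin n) - √T ≤
      ∫ w, m w ∂gaussianPi (Fin n × Fin T) := by
  refine le_of_forall_pos_le_add_mul (C := 2) fun δ hδ => ?_
  have hclose : ∀ y, |c * smoothNorm δ L y - c * ‖L y‖| ≤ δ := fun y => by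
    rw [← mul_sub, abs_mul, hc, one_mul, abs_of_nonneg (sub_nonneg.2 (norm_le_smoothNorm y))]
    linarith [smoothNorm_le (L := L) hδ y]
  have hdiff : Differentiable ℝ (smoothNorm δ L) :=
    (contDiff_smoothNorm hδ).differentiable (by norm_num)
  have hf1 : fderiv ℝ (fun y => c * smoothNorm δ L y) = fun y => c • fderiv ℝ (smoothNorm δ L) y :=
    funext fun y => fderiv_const_mul (hdiff y) c
  have hlip1 : ∀ x y, |c * smoothNorm δ L x - c * smoothNorm δ L y| ≤ ‖x - y‖ := fun x y => by
    rw [← mul_sub, abs_mul, hc, one_mul]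
    refine (abs_smoothNorm_sub_le hδ x y).trans ?_
    rw [← map_sub]; exact hL _
  have hN1 : ∀ y, ‖fderiv ℝ (fun y => c * smoothNorm δ L y) y‖ ≤ 1 := fun y => by
    have : LipschitzWith 1 fun y => c * smoothNorm δ L y :=
      LipschitzWith.of_dist_le_mul fun x y => by
        simpa [Real.dist_eq, dist_eq_norm] using hlip1 x y
    simpa using norm_fderiv_le_of_lipschitz ℝ this (x₀ := y)
  have hN2 : ∀ y, ‖fderiv ℝ (fderiv ℝ (fun y => c * smoothNorm δ L y)) y‖ ≤ 2 * δ⁻¹ := fun y => by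
    have hd : Differentiable ℝ (fderiv ℝ (smoothNorm δ L)) :=
      ((contDiff_smoothNorm hδ).fderiv_right (m := 1) (by norm_num)).differentiable (by norm_num)
    rw [hf1, fderiv_fun_const_smul (hd y)]
    rcases eq_or_eq_neg_of_abs_eq hc with rfl | rfl
    · rw [one_smul]
      exact norm_fderiv_fderiv_smoothNorm_le hδ hL y
    · rw [neg_one_smul, ContinuousLinearMap.opNorm_neg]
      exact norm_fderiv_fderiv_smoothNorm_le hδ hL y
  have key := gordon_sphere (N := fun y => c * smoothNorm δ L y)
    (contDiff_const.mul (contDiff_smoothNorm hδ)) hN1 hN2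
    (hm.add (integrable_const δ)) fun w => by
      obtain ⟨v, hv, hvm⟩ := h w
      refine ⟨v, hv, ?_⟩
      have := (abs_le.1 (hclose (matrixOp n T w v))).2
      simp only [Pi.add_apply]
      linarith
  have hi : c * ∫ g : Fin n → ℝ, ‖L (WithLp.toLp 2 g)‖ ∂gaussianPi (Fin n) - δ ≤
      ∫ g : Fin n → ℝ, c * smoothNorm δ L (WithLp.toLp 2 g) ∂gaussianPi (Fin n) := by
    have hlip2 : ∀ x y : EuclideanSpace ℝ (Fin n), |c * ‖L x‖ - c * ‖L y‖| ≤ ‖x - y‖ := fun x y => by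
      rw [← mul_sub, abs_mul, hc, one_mul]
      refine (abs_norm_sub_norm_le _ _).trans ?_
      rw [← map_sub]; exact hL _
    have i1 := integrable_of_lipschitz_gaussianPi hlip2
    have i2 := integrable_of_lipschitz_gaussianPi hlip1
    have : ∫ g : Fin n → ℝ, (c * ‖L (WithLp.toLp 2 g)‖ - δ) ∂gaussianPi (Fin n) ≤
        ∫ g : Fin n → ℝ, c * smoothNorm δ L (WithLp.toLp 2 g) ∂gaussianPi (Fin n) := by
      refine integral_mono (i1.sub (integrable_const _)) i2 fun g => ?_
      have := (abs_le.1 (hclose (WithLp.toLp 2 g))).1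
      simp only
      linarith
    rw [integral_sub i1 (integrable_const _), integral_const_mul, integral_const] at this
    simpa using this
  have e : ∫ w, (m w + δ) ∂gaussianPi (Fin n × Fin T) =
      ∫ w, m w ∂gaussianPi (Fin n × Fin T) + δ := by
    rw [integral_add hm (integrable_const _), integral_const]; simp
  simp only [Pi.add_apply] at key
  rw [e] at key
  linarith

end GordonSphere

/-! ### Singular values of Gaussian perturbations -/

section Perturbation

variable {n T : ℕ}

theorem matrixOp_entries (E : Matrix (Fin n) (Fin T) ℝ) (v : EuclideanSpace ℝ (Fin T)) :
    matrixOp n T (fun p => E p.1 p.2) v = Matrix.toEuclideanLin E v := by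
  rfl

theorem Matrix.singularValues_toEuclideanLin_rank {m ι : Type*} [Fintype m] [Fintype ι]
    [DecidableEq ι] (S : Matrix m ι ℝ) :
    (Matrix.toEuclideanLin S).singularValues S.rank = 0 := by
  classical
  have h : S.rank = Module.finrank ℝ (LinearMap.range (Matrix.toEuclideanLin S)) := by
    rw [Matrix.toEuclideanLin_eq_toLin_orthonormal]
    exact Matrix.rank_eq_finrank_range_toLin _ _ _
  rw [h, LinearMap.singularValues_finrank_range_self]

/-- Selecting rows does not increase the norm of the noise, and `σ*` of a signal plus noise is at
most the norm of the noise by Weyl's inequality, as the signal has no singular value of index equal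
to its rank. -/
theorem sigmaStar_rowsOf_le (M E : Matrix (Fin n) (Fin T) ℝ) (I : Finset (Fin n)) :
    sigmaStar (rowsOf M I) (rowsOf (M + E) I) ≤ ‖matrixOp n T fun p => E p.1 p.2‖ := by
  have h := LinearMap.singularValues_le_add (Matrix.toEuclideanLin (rowsOf (M + E) I))
    (Matrix.toEuclideanLin (rowsOf M I)) (rowsOf M I).rank
    (C := ‖matrixOp n T fun p => E p.1 p.2‖) (norm_nonneg _) fun v => by
      refine le_trans ?_ ((matrixOp n T fun p => E p.1 p.2).le_opNorm v)
      rw [← LinearMap.sub_apply, ← map_sub]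
      have e : rowsOf (M + E) I - rowsOf M I = rowsOf E I := by
        ext i j; simp [rowsOf]
      rw [e, matrixOp_entries]
      refine le_of_sq_le_sq ?_ (norm_nonneg _)
      rw [EuclideanSpace.norm_sq_eq, EuclideanSpace.norm_sq_eq]
      have e2 : ∀ i : I, Matrix.toEuclideanLin (rowsOf E I) v i =
          Matrix.toEuclideanLin E v (i : Fin n) := fun i => rfl
      simp_rw [e2]
      rw [Finset.sum_coe_sort I fun i => ‖Matrix.toEuclideanLin E v i‖ ^ 2]
      exact Finset.sum_le_sum_of_subset_of_nonneg (Finset.subset_univ _) fun _ _ _ => by positivity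
  rwa [Matrix.singularValues_toEuclideanLin_rank, zero_add] at h

theorem sigmaStar_nonneg {m ι : Type*} [Fintype m] [Fintype ι] [DecidableEq ι]
    (S A : Matrix m ι ℝ) : 0 ≤ sigmaStar S A :=
  LinearMap.singularValues_nonneg _ _

/-- `σ*` of a perturbation `M + E` dominates the least value of `‖Q E v‖` on the unit sphere, where
`Q` projects onto the orthogonal complement of the range of `M`. -/
theorem exists_norm_projection_le_sigmaStar (M E : Matrix (Fin n) (Fin T) ℝ) (hM : M.rank < T) :
    ∃ v : EuclideanSpace ℝ (Fin T), ‖v‖ = 1 ∧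
      ‖(LinearMap.range (Matrix.toEuclideanLin M))ᗮ.starProjection
        (matrixOp n T (fun p => E p.1 p.2) v)‖ ≤ sigmaStar M (M + E) := by
  obtain ⟨v, hv, hvσ⟩ := (Matrix.toEuclideanLin (M + E)).exists_norm_apply_eq_singularValues
    (j := M.rank) (by simpa using hM)
  refine ⟨v, hv, ?_⟩
  rw [sigmaStar, singVal, ← hvσ, matrixOp_entries, map_add, LinearMap.add_apply]
  set R := LinearMap.range (Matrix.toEuclideanLin M)
  have h0 : Rᗮ.starProjection (Matrix.toEuclideanLin M v) = 0 := by
    rw [Submodule.starProjection_apply_eq_zero_iff, Submodule.orthogonal_orthogonal]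
    exact LinearMap.mem_range_self _ _
  calc _ = ‖Rᗮ.starProjection (Matrix.toEuclideanLin M v + Matrix.toEuclideanLin E v)‖ := by
        rw [map_add, h0, zero_add]
    _ ≤ _ := Submodule.norm_starProjection_apply_le _ _

theorem abs_sigmaStar_sub_le (M E E' : Matrix (Fin n) (Fin T) ℝ) :
    |sigmaStar M (M + E) - sigmaStar M (M + E')| ≤ ‖matrixOp n T fun p => (E - E') p.1 p.2‖ := by
  have key : ∀ E E' : Matrix (Fin n) (Fin T) ℝ,
      sigmaStar M (M + E) ≤ sigmaStar M (M + E') + ‖matrixOp n T fun p => (E - E') p.1 p.2‖ := by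
    intro E E'
    refine LinearMap.singularValues_le_add _ _ _ (norm_nonneg _) fun v => ?_
    rw [← LinearMap.sub_apply, ← map_sub, add_sub_add_left_eq_sub, ← matrixOp_entries]
    exact ContinuousLinearMap.le_opNorm _ v
  have h1 := key E E'
  have h2 := key E' E
  have e : (fun p : Fin n × Fin T => (E' - E) p.1 p.2) = -fun p => (E - E') p.1 p.2 := by
    ext p; simp
  rw [e, map_neg, norm_neg] at h2
  exact abs_le.2 ⟨by linarith, by linarith⟩

theorem continuous_sigmaStar (M : Matrix (Fin n) (Fin T) ℝ) :
    Continuous fun w : Fin n × Fin T → ℝ => sigmaStar M (M + Matrix.of fun i t => w (i, t)) := by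
  refine (LipschitzWith.of_dist_le_mul (K := ‖matrixOp n T‖₊) fun w w' => ?_).continuous
  rw [Real.dist_eq, dist_eq_norm]
  exact (abs_sigmaStar_sub_le _ _ _).trans ((matrixOp n T).le_opNorm (w - w'))

theorem integral_sq_inner_gaussianPi (b : EuclideanSpace ℝ (Fin n)) :
    Integrable (fun g : Fin n → ℝ => (inner ℝ b (WithLp.toLp 2 g)) ^ 2) (gaussianPi (Fin n)) ∧
      ∫ g : Fin n → ℝ, (inner ℝ b (WithLp.toLp 2 g)) ^ 2 ∂gaussianPi (Fin n) = ‖b‖ ^ 2 := by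
  have e' : ∀ g : Fin n → ℝ, inner ℝ b (WithLp.toLp 2 g) = ∑ i, b i * g i := fun g => by
    rw [PiLp.inner_apply]
    exact Finset.sum_congr rfl fun i _ => by simp [mul_comm]
  have e : (fun g : Fin n → ℝ => inner ℝ b (WithLp.toLp 2 g)) =
      ∑ i, fun g : Fin n → ℝ => b i * g i := by
    ext g
    rw [e', Finset.sum_apply]
  have hmem : ∀ i, MemLp (fun x : ℝ => b i * x) 2 (gaussianReal 0 1) := fun i =>
    (memLp_id_gaussianReal (μ := 0) (v := 1) 2).const_mul (b i)
  have hL : MemLp (fun g : Fin n → ℝ => inner ℝ b (WithLp.toLp 2 g)) 2 (gaussianPi (Fin n)) := by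
    rw [e]
    exact memLp_finsetSum' _ fun i _ =>
      (hmem i).comp_measurePreserving (measurePreserving_eval (fun _ : Fin n => gaussianReal 0 1) i)
  refine ⟨hL.integrable_sq, ?_⟩
  have hmean : ∫ g : Fin n → ℝ, inner ℝ b (WithLp.toLp 2 g) ∂gaussianPi (Fin n) = 0 := by
    simp_rw [e']
    rw [integral_finsetSum _ fun i _ => (integrable_eval_gaussianPi i).const_mul _]
    simp [integral_const_mul, integral_eval_gaussianPi]
  have hvar := variance_of_integral_eq_zero hL.aemeasurable hmean
  rw [← hvar, e]
  have h2 := variance_sum_pi (μ := fun _ : Fin n => gaussianReal 0 1)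
    (X := fun i x => b i * x) hmem
  rw [h2, EuclideanSpace.norm_sq_eq]
  refine Finset.sum_congr rfl fun i _ => ?_
  rw [variance_const_mul, variance_fun_id_gaussianReal]
  simp

/-- The projection of a standard Gaussian vector to `R` has mean square norm `dim R`. -/
theorem integral_norm_starProjection_gaussianPi_le (R : Submodule ℝ (EuclideanSpace ℝ (Fin n))) :
    ∫ g : Fin n → ℝ, ‖R.starProjection (WithLp.toLp 2 g)‖ ∂gaussianPi (Fin n) ≤
      √(Module.finrank ℝ R) := by
  let b := stdOrthonormalBasis ℝ R
  refine integral_le_of_integral_sq_le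
    (g := fun g : Fin n → ℝ =>
      ∑ i, (inner ℝ (b i : EuclideanSpace ℝ (Fin n)) (WithLp.toLp 2 g)) ^ 2)
    (Real.sqrt_nonneg _) (integrable_of_lipschitz_gaussianPi
      (N := fun y => ‖R.starProjection y‖) fun x y => ?_)
    (integrable_finsetSum _ fun i _ => (integral_sq_inner_gaussianPi _).1) (fun g => ?_) ?_
  · refine (abs_norm_sub_norm_le _ _).trans ?_
    rw [← map_sub]
    exact Submodule.norm_starProjection_apply_le _ _
  · rw [Submodule.starProjection_apply, ← Submodule.coe_norm, ← b.sum_sq_norm_inner_right]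
    refine (Finset.sum_congr rfl fun i _ => ?_).le
    rw [Real.norm_eq_abs, sq_abs, Submodule.inner_orthogonalProjectionOnto_eq_of_mem_left]
  · rw [integral_finsetSum _ fun i _ => (integral_sq_inner_gaussianPi _).1,
      Real.sq_sqrt (by positivity)]
    refine (Finset.sum_congr rfl fun i _ => (integral_sq_inner_gaussianPi _).2).le.trans ?_
    have : ∀ i, ‖(b i : EuclideanSpace ℝ (Fin n))‖ = 1 := fun i => b.norm_eq_one i
    simp [this]

/-- The expected operator norm of Gaussian noise exceeds the expected `σ*` of a rank-deficient
signal plus noise by at most `3 s √T`: Chevet bounds the norm by `s (𝔼 ‖g‖ + √T)`, Gordon bounds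
`σ*` below by `s (𝔼 ‖Q g‖ - √T)`, and `𝔼 ‖g‖ - 𝔼 ‖Q g‖ ≤ √(rank M)`. The term `𝔼 ‖g‖`
cancels and never needs to be estimated. -/
theorem integral_opNorm_sub_integral_sigmaStar_le (M : Matrix (Fin n) (Fin T) ℝ) (hM : M.rank < T)
    {s : ℝ} (hs : 0 ≤ s) :
    Integrable (fun w => ‖matrixOp n T (s • w)‖) (gaussianPi (Fin n × Fin T)) ∧
    Integrable (fun w : Fin n × Fin T → ℝ =>
      sigmaStar M (M + Matrix.of fun i t => (s • w) (i, t))) (gaussianPi (Fin n × Fin T)) ∧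
    ∫ w, ‖matrixOp n T (s • w)‖ ∂gaussianPi (Fin n × Fin T) -
      ∫ w : Fin n × Fin T → ℝ, sigmaStar M (M + Matrix.of fun i t => (s • w) (i, t))
        ∂gaussianPi (Fin n × Fin T) ≤ 3 * s * √T := by
  have hT : 0 < T := (Nat.zero_le _).trans_lt hM
  have iN : Integrable (fun w => ‖matrixOp n T w‖) (gaussianPi (Fin n × Fin T)) := by
    refine (integrable_norm_gaussianPi.const_mul ‖matrixOp n T‖).mono'
      (continuous_norm.comp (matrixOp n T).continuous).aestronglyMeasurable
      (ae_of_all _ fun w => ?_)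
    rw [norm_norm]
    exact (matrixOp n T).le_opNorm w
  have hnorm : ∀ w, ‖matrixOp n T (s • w)‖ = s * ‖matrixOp n T w‖ := fun w => by
    rw [map_smul, norm_smul, Real.norm_of_nonneg hs]
  have iσ : Integrable (fun w : Fin n × Fin T → ℝ =>
      sigmaStar M (M + Matrix.of fun i t => (s • w) (i, t))) (gaussianPi (Fin n × Fin T)) := by
    refine ((integrable_const (sigmaStar M (M + 0))).add (iN.const_mul s)).mono'
      ((continuous_sigmaStar M).comp (continuous_const_smul s)).aestronglyMeasurable
      (ae_of_all _ fun w => ?_)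
    have h1 := abs_sigmaStar_sub_le M (Matrix.of fun i t => (s • w) (i, t)) 0
    rw [sub_zero] at h1
    have h2 : ‖matrixOp n T (s • w)‖ = s * ‖matrixOp n T w‖ := hnorm w
    have h3 : |sigmaStar M (M + Matrix.of fun i t => (s • w) (i, t)) - sigmaStar M (M + 0)| ≤
        s * ‖matrixOp n T w‖ := h2 ▸ h1
    rw [Real.norm_of_nonneg (sigmaStar_nonneg _ _), Pi.add_apply]
    linarith [(abs_le.1 h3).2]
  refine ⟨(iN.const_mul s).congr (ae_of_all _ fun w => (hnorm w).symm), iσ, ?_⟩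
  simp_rw [hnorm]
  rw [integral_const_mul]
  rcases hs.eq_or_lt with rfl | hs0
  · have : 0 ≤ ∫ w : Fin n × Fin T → ℝ, sigmaStar M (M + Matrix.of fun i t => ((0 : ℝ) • w) (i, t))
        ∂gaussianPi (Fin n × Fin T) := integral_nonneg fun _ => sigmaStar_nonneg _ _
    linarith
  set R := LinearMap.range (Matrix.toEuclideanLin M) with hR
  have hQ : ∀ y, ‖Rᗮ.starProjection y‖ ≤ ‖y‖ := Submodule.norm_starProjection_apply_le _
  have gordon := gordon_norm (T := T) (L := Rᗮ.starProjection) hQ (c := 1) (by simp)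
    (iσ.const_mul s⁻¹) fun w => by
      obtain ⟨v, hv, hvσ⟩ := exists_norm_projection_le_sigmaStar M
        (Matrix.of fun i t => (s • w) (i, t)) hM
      refine ⟨v, hv, ?_⟩
      have e : matrixOp n T (fun p => Matrix.of (fun i t => (s • w) (i, t)) p.1 p.2) v =
          s • matrixOp n T w v := by
        change matrixOp n T (s • w) v = _
        rw [map_smul]; rfl
      rw [e, map_smul, norm_smul, Real.norm_of_nonneg hs] at hvσ
      rw [one_mul, inv_mul_eq_div, le_div_iff₀' hs0]
      exact hvσ
  have chevet := gordon_norm (T := T) (L := ContinuousLinearMap.id ℝ (EuclideanSpace ℝ (Fin n)))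
    (fun _ => le_rfl) (c := -1) (by simp) iN.neg fun w => by
      have : Nontrivial (EuclideanSpace ℝ (Fin T)) := by
        have : Nonempty (Fin T) := ⟨⟨0, hT⟩⟩
        infer_instance
      obtain ⟨v, hv, hmax⟩ := (isCompact_sphere (0 : EuclideanSpace ℝ (Fin T)) 1).exists_isMaxOn
        (NormedSpace.sphere_nonempty.2 zero_le_one) ((matrixOp n T w).continuous.norm.continuousOn)
      refine ⟨v, mem_sphere_zero_iff_norm.1 hv, ?_⟩
      have := ContinuousLinearMap.opNorm_le_of_unit_norm (f := matrixOp n T w) (norm_nonneg _)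
        fun x hx => hmax (mem_sphere_zero_iff_norm.2 hx)
      simpa using this
  have proj := integral_norm_starProjection_gaussianPi_le R
  have hRT : √(Module.finrank ℝ R : ℝ) ≤ √T := by
    refine Real.sqrt_le_sqrt ?_
    have h := LinearMap.finrank_range_le (Matrix.toEuclideanLin M)
    rw [finrank_euclideanSpace_fin] at h
    exact_mod_cast h
  have iP : ∀ U : Submodule ℝ (EuclideanSpace ℝ (Fin n)), Integrable (fun g : Fin n → ℝ =>
      ‖U.starProjection (WithLp.toLp 2 g)‖) (gaussianPi (Fin n)) := fun U =>
    integrable_of_lipschitz_gaussianPi (N := fun y => ‖U.starProjection y‖) fun x y => by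
      refine (abs_norm_sub_norm_le _ _).trans ?_
      rw [← map_sub]
      exact Submodule.norm_starProjection_apply_le _ _
  have split : ∫ g : Fin n → ℝ, ‖WithLp.toLp 2 g‖ ∂gaussianPi (Fin n) ≤
      ∫ g : Fin n → ℝ, ‖R.starProjection (WithLp.toLp 2 g)‖ ∂gaussianPi (Fin n) +
        ∫ g : Fin n → ℝ, ‖Rᗮ.starProjection (WithLp.toLp 2 g)‖ ∂gaussianPi (Fin n) := by
    rw [← integral_add (iP R) (iP Rᗮ)]
    refine integral_mono integrable_norm_toLp_gaussianPi ((iP R).add (iP Rᗮ)) fun g => ?_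
    have := Submodule.starProjection_add_starProjection_orthogonal (K := R) (WithLp.toLp 2 g)
    calc ‖WithLp.toLp 2 g‖ = ‖R.starProjection (WithLp.toLp 2 g) +
          Rᗮ.starProjection (WithLp.toLp 2 g)‖ := by rw [this]
      _ ≤ _ := norm_add_le _ _
  simp only [ContinuousLinearMap.id_apply, Pi.neg_apply] at chevet
  rw [integral_neg] at chevet
  rw [integral_const_mul] at gordon
  set σ := ∫ w : Fin n × Fin T → ℝ, sigmaStar M (M + Matrix.of fun i t => (s • w) (i, t))
    ∂gaussianPi (Fin n × Fin T)
  set ν := ∫ w, ‖matrixOp n T w‖ ∂gaussianPi (Fin n × Fin T)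
  have h : ν - s⁻¹ * σ ≤ 3 * √T := by linarith
  have := mul_le_mul_of_nonneg_left h hs
  have e : s * (ν - s⁻¹ * σ) = s * ν - σ := by field_simp
  linarith

end Perturbation

/-! ### Comparison of the two bounds -/

section Bounds

variable {Ω : Type*} [MeasurableSpace Ω] {P : Measure Ω} {n T : ℕ}

theorem IsGaussianNoise.aemeasurable_entries {s : ℝ≥0} {E : Ω → Matrix (Fin n) (Fin T) ℝ}
    (hE : IsGaussianNoise P s E) : AEMeasurable (fun ω (p : Fin n × Fin T) => E ω p.1 p.2) P :=
  aemeasurable_pi_iff.2 fun p => (hE.2 p.1 p.2).aemeasurable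

/-- The noise has the law of `s` times a standard Gaussian matrix. -/
theorem IsGaussianNoise.map_entries {s : ℝ≥0} {E : Ω → Matrix (Fin n) (Fin T) ℝ}
    (hE : IsGaussianNoise P s E) :
    P.map (fun ω (p : Fin n × Fin T) => E ω p.1 p.2) =
      (gaussianPi (Fin n × Fin T)).map fun w => (s : ℝ) • w := by
  have h0 : P.map (fun ω (p : Fin n × Fin T) => E ω p.1 p.2) =
      Measure.pi fun p : Fin n × Fin T => P.map fun ω => E ω p.1 p.2 :=
    hE.1.map_fun_eq_pi_map fun p => (hE.2 p.1 p.2).aemeasurable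
  rw [h0]
  have h := Measure.pi_map_pi (μ := fun _ : Fin n × Fin T => gaussianReal 0 1)
    (f := fun _ x => (s : ℝ) * x) fun _ => (measurable_const_mul _).aemeasurable
  have e : (fun w : Fin n × Fin T → ℝ => (s : ℝ) • w) = fun x i => (s : ℝ) * x i := rfl
  rw [e, h]
  congr 1
  ext1 p
  rw [(hE.2 p.1 p.2).map_eq, gaussianReal_map_const_mul]
  congr 1
  · simp
  · ext; simp

theorem IsGaussianNoise.integrable_comp_iff {s : ℝ≥0} {E : Ω → Matrix (Fin n) (Fin T) ℝ}
    (hE : IsGaussianNoise P s E) {f : (Fin n × Fin T → ℝ) → ℝ} (hf : Continuous f) :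
    Integrable (fun ω => f fun p => E ω p.1 p.2) P ↔
      Integrable (fun w => f ((s : ℝ) • w)) (gaussianPi (Fin n × Fin T)) := by
  have h1 := integrable_map_measure (f := fun ω (p : Fin n × Fin T) => E ω p.1 p.2) (μ := P)
    (g := f) hf.aestronglyMeasurable hE.aemeasurable_entries
  have h2 := integrable_map_measure (f := fun w : Fin n × Fin T → ℝ => (s : ℝ) • w)
    (μ := gaussianPi (Fin n × Fin T)) (g := f) hf.aestronglyMeasurable
    (measurable_const_smul (s : ℝ)).aemeasurable
  rw [hE.map_entries] at h1
  exact h1.symm.trans h2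

theorem IsGaussianNoise.integral_comp {s : ℝ≥0} {E : Ω → Matrix (Fin n) (Fin T) ℝ}
    (hE : IsGaussianNoise P s E) {f : (Fin n × Fin T → ℝ) → ℝ} (hf : Continuous f) :
    ∫ ω, f (fun p => E ω p.1 p.2) ∂P = ∫ w, f ((s : ℝ) • w) ∂gaussianPi (Fin n × Fin T) := by
  rw [← integral_map (φ := fun ω (p : Fin n × Fin T) => E ω p.1 p.2) hE.aemeasurable_entries
    hf.aestronglyMeasurable, hE.map_entries,
    integral_map (measurable_const_smul (s : ℝ)).aemeasurable hf.aestronglyMeasurable]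

variable [IsProbabilityMeasure P]

theorem integrable_comp_of_nullMeasurable_fibers {κ : Type*} [Fintype κ] {I : Ω → κ}
    (hI : ∀ J, NullMeasurableSet {ω | I ω = J} P) (f : κ → ℝ) :
    Integrable (fun ω => f (I ω)) P := by
  classical
  have h : Integrable (fun ω => ∑ J, {ω | I ω = J}.indicator (fun _ => f J) ω) P :=
    integrable_finsetSum _ fun J _ => (integrable_const (f J)).indicator₀ (hI J)
  refine h.congr (ae_of_all _ fun ω => ?_)
  simp [Set.indicator_apply]

theorem integral_sqrt_card_le {I : Ω → Finset (Fin n)}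
    (hI : ∀ J, NullMeasurableSet {ω | I ω = J} P) {b : ℝ} (hb : 0 ≤ b)
    (h : meanSize P I ≤ b ^ 2) : ∫ ω, √((I ω).card : ℝ) ∂P ≤ b :=
  integral_le_of_integral_sq_le hb
    (integrable_comp_of_nullMeasurable_fibers hI fun J => √(J.card : ℝ))
    (integrable_comp_of_nullMeasurable_fibers hI fun J => (J.card : ℝ))
    (fun ω => (Real.sq_sqrt (by positivity)).le) h

/-- The size condition says that the expected root of the number of selected donors is smaller than
`√n - 2 √T`, since `n + 4 T - 4 √(n T) = (√n - 2 √T)²`. -/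
theorem integral_sqrt_card_lt {I : Ω → Finset (Fin n)}
    (hI : ∀ J, NullMeasurableSet {ω | I ω = J} P) (hn : 4 * T ≤ n)
    (h : meanSize P I < n + 4 * T - 4 * √((n : ℝ) * T)) :
    ∫ ω, √((I ω).card : ℝ) ∂P < √n - 2 * √T := by
  have hn' : 2 * √(T : ℝ) ≤ √n := by
    refine Real.le_sqrt_of_sq_le ?_
    rw [mul_pow, Real.sq_sqrt (by positivity)]
    norm_num
    exact_mod_cast hn
  have e : (n : ℝ) + 4 * T - 4 * √((n : ℝ) * T) = (√n - 2 * √T) ^ 2 := by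
    rw [Real.sqrt_mul (by positivity), sub_sq, mul_pow, Real.sq_sqrt (by positivity),
      Real.sq_sqrt (by positivity)]
    ring
  have h0 : 0 ≤ meanSize P I := integral_nonneg fun _ => by positivity
  calc _ ≤ √(meanSize P I) := integral_sqrt_card_le hI (Real.sqrt_nonneg _)
          (Real.sq_sqrt h0).ge
    _ < √n - 2 * √T := by
      rw [← Real.sqrt_sq (sub_nonneg.2 hn'), ← e]
      exact Real.sqrt_lt_sqrt h0 h

/-- The gap between the bounds in terms of `D = √n - 𝔼 √|I|`. The selected `σ*` is bounded by the
norm of the whole noise matrix, which needs no measurability of the former and no independence of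
the selection from the noise. -/
theorem le_fullPoolBound_sub_selectedBound {T₀ : ℕ} {μ η : ℝ} (hη : 0 ≤ η)
    {s : ℝ≥0} {M : Matrix (Fin n) (Fin T) ℝ} {E : Ω → Matrix (Fin n) (Fin T) ℝ}
    {I : Ω → Finset (Fin n)} (hM : M.rank < T) (hE : IsGaussianNoise P s E)
    (hI : ∀ J, NullMeasurableSet {ω | I ω = J} P) :
    η / √((T : ℝ) - T₀) * (s * (2 * (√n - ∫ ω, √((I ω).card : ℝ) ∂P) - 3 * √T)) +
        (√n - ∫ ω, √((I ω).card : ℝ) ∂P) * (μ + η) ≤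
      fullPoolBound P T₀ μ η s M E - selectedBound P T₀ μ η s M E I := by
  obtain ⟨iN, iσ, hmain⟩ := integral_opNorm_sub_integral_sigmaStar_le M hM s.coe_nonneg
  have cN : Continuous fun w => ‖matrixOp n T w‖ := (matrixOp n T).continuous.norm
  have cσ := continuous_sigmaStar M
  have iN' : Integrable (fun ω => ‖matrixOp n T fun p => E ω p.1 p.2‖) P :=
    (hE.integrable_comp_iff cN).2 iN
  have iσ' : Integrable (fun ω => sigmaStar M (M + E ω)) P := (hE.integrable_comp_iff cσ).2 iσ
  have eN : ∫ ω, ‖matrixOp n T fun p => E ω p.1 p.2‖ ∂P = _ := hE.integral_comp cN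
  have eσ : ∫ ω, sigmaStar M (M + E ω) ∂P = _ := hE.integral_comp cσ
  rw [← eN, ← eσ] at hmain
  have iI := integrable_comp_of_nullMeasurable_fibers hI fun J => √(J.card : ℝ)
  set A := ∫ ω, √((I ω).card : ℝ) ∂P with hA
  set ν := ∫ ω, ‖matrixOp n T fun p => E ω p.1 p.2‖ ∂P with hν
  set τ := ∫ ω, sigmaStar M (M + E ω) ∂P with hτ
  have hfull : ∫ ω, (sigmaStar M (M + E ω) + 2 * (s : ℝ) * (√(n : ℝ) + √(T : ℝ))) ∂P =
      τ + 2 * s * (√n + √T) := by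
    rw [integral_add iσ' (integrable_const _), integral_const]; simp [hτ]
  have iR : Integrable (fun ω => 2 * (s : ℝ) * (√((I ω).card : ℝ) + √(T : ℝ))) P :=
    (iI.add (integrable_const _)).const_mul _
  have hsel : ∫ ω, (sigmaStar (rowsOf M (I ω)) (rowsOf (M + E ω) (I ω)) +
      2 * (s : ℝ) * (√((I ω).card : ℝ) + √(T : ℝ))) ∂P ≤ ν + 2 * s * (A + √T) := by
    calc _ ≤ ∫ ω, (‖matrixOp n T fun p => E ω p.1 p.2‖ +
          2 * (s : ℝ) * (√((I ω).card : ℝ) + √(T : ℝ))) ∂P := by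
          refine integral_mono_of_nonneg (ae_of_all _ fun ω => ?_) (iN'.add iR)
            (ae_of_all _ fun ω => ?_)
          · have := sigmaStar_nonneg (rowsOf M (I ω)) (rowsOf (M + E ω) (I ω))
            simp only [Pi.zero_apply]
            positivity
          · exact add_le_add (sigmaStar_rowsOf_le _ _ _) le_rfl
      _ = _ := by
          rw [integral_add iN' iR, integral_const_mul, integral_add iI (integrable_const _),
            integral_const]
          simp [hν, hA]
  have hκ : 0 ≤ η / √((T : ℝ) - T₀) := div_nonneg hη (Real.sqrt_nonneg _)
  unfold fullPoolBound selectedBound postRMSEBound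
  rw [hfull, integral_const]
  simp only [probReal_univ, one_smul]
  have h1 := mul_le_mul_of_nonneg_left hsel hκ
  have h2 : η / √((T : ℝ) - T₀) * (s * (2 * (√n - A) - 3 * √T)) ≤
      η / √((T : ℝ) - T₀) * (τ + 2 * s * (√n + √T) - (ν + 2 * s * (A + √T))) := by
    refine mul_le_mul_of_nonneg_left ?_ hκ
    linarith
  rw [mul_sub] at h2
  linarith

end Bounds

theorem theorem4p19 (T T₀ : ℕ) (hT₀ : 0 < T₀) (hT : T₀ < T) (μ η : ℝ) (hμ : 0 < μ) (hη : 0 ≤ η)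
    (α : ℝ) (hα : α ∈ Set.Ioo (0 : ℝ) 1) :
    ∃ c : ℝ, 0 < c ∧
      ∀ {Ω : Type*} [MeasurableSpace Ω] (P : Measure Ω) [IsProbabilityMeasure P]
        (n k : ℕ) (s : ℝ≥0) (M : Matrix (Fin n) (Fin T) ℝ) (E : Ω → Matrix (Fin n) (Fin T) ℝ)
        (x₀ : Ω → Fin T → ℝ) (I : Ω → Finset (Fin n)),
        4 * T ≤ n →
        M.rank < T →
        IsGaussianNoise P s E →
        (∀ J, NullMeasurableSet {ω | I ω = J} P) →
        ((∀ᵐ ω ∂P, ClusterSCSelects hT k M.rank (M + E ω) (x₀ ω) (I ω)) ∨ ∃ J, ∀ ω, I ω = J) →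
        meanSize P I < n + 4 * T - 4 * √((n : ℝ) * T) →
        selectedBound P T₀ μ η s M E I < fullPoolBound P T₀ μ η s M E ∧
          (0 < η → meanSize P I ≤ α ^ 2 * n →
            c * ((s : ℝ) * √(n : ℝ)) ≤ fullPoolBound P T₀ μ η s M E - selectedBound P T₀ μ η s M E I) := by
  obtain ⟨hα0, hα1⟩ := hα
  have hTT : 0 < √((T : ℝ) - T₀) := Real.sqrt_pos.2 (sub_pos.2 (by exact_mod_cast hT))
  refine ⟨if 0 < η then η / √((T : ℝ) - T₀) * ((1 - α) / 2) else 1, ?_, ?_⟩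
  · split_ifs with h
    · have : 0 < 1 - α := sub_pos.2 hα1
      positivity
    · exact one_pos
  intro Ω _ P _ n k s M E x₀ I hn hM hE hI _ hsize
  have hgap := le_fullPoolBound_sub_selectedBound (T₀ := T₀) (μ := μ) hη hM hE hI
  have hD := integral_sqrt_card_lt hI hn hsize
  set D := √(n : ℝ) - ∫ ω, √((I ω).card : ℝ) ∂P with hDdef
  have hT' := Real.sqrt_nonneg (T : ℝ)
  have hDT : 2 * √(T : ℝ) < D := by rw [hDdef]; linarith
  have hDpos : 0 < D := by linarith
  have hκ : 0 ≤ η / √((T : ℝ) - T₀) := div_nonneg hη hTT.le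
  -- Since `D > 2 √T`, the deficit `3 √T` leaves at least a quarter of the gain `2 D`.
  have hs : (s : ℝ) * (D / 2) ≤ s * (2 * D - 3 * √T) :=
    mul_le_mul_of_nonneg_left (by linarith) s.coe_nonneg
  have hgap' : η / √((T : ℝ) - T₀) * (s * (D / 2)) + D * (μ + η) ≤
      fullPoolBound P T₀ μ η s M E - selectedBound P T₀ μ η s M E I :=
    (add_le_add (mul_le_mul_of_nonneg_left hs hκ) le_rfl).trans hgap
  have hpos : 0 < D * (μ + η) := mul_pos hDpos (by linarith)
  refine ⟨?_, fun hη0 hα2 => ?_⟩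
  · have : 0 ≤ η / √((T : ℝ) - T₀) * (s * (D / 2)) := by positivity
    linarith
  · rw [if_pos hη0]
    have hA : ∫ ω, √((I ω).card : ℝ) ∂P ≤ α * √n :=
      integral_sqrt_card_le hI (by positivity)
        (hα2.trans_eq (by rw [mul_pow, Real.sq_sqrt (by positivity)]))
    have hD2 : (1 - α) * √n ≤ D := by rw [hDdef]; linarith
    calc η / √((T : ℝ) - T₀) * ((1 - α) / 2) * (s * √n)
        = η / √((T : ℝ) - T₀) * (s * ((1 - α) * √n / 2)) := by ring
      _ ≤ η / √((T : ℝ) - T₀) * (s * (D / 2)) := by gcongr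
      _ ≤ _ := by linarith
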